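/- **Setting.** Let $M$ be a compact 3-manifold with boundary, with a handle structure $\mathcal H$ obtained by thickening a spine of $M$: $M$ is a union of finitely many 0-handles $D^3$, 1-handles $D^1\times D^2$ and 2-handles $D^2\times D^1$ (no 3-handles). Handles of equal index are disjoint, 1-handles are attached to the boundaries of the 0-handles along $\partial D^1\times D^2$, 2-handles are attached along $\partial D^2\times D^1$, they respect the product structure of the 1-handles, and each 2-handle touches some 1-handle. Write $\mathcal H^i$ for the union of the $i$-handles, $\mathcal F=\mathcal H^0\cap(\mathcal H^1\cup\mathcal H^2)$, $\mathcal F^0=\mathcal H^0\cap\mathcal H^1$ (a union of discs, the 0-handles of $\mathcal F$) and $\mathcal F^1=\mathcal H^0\cap\mathcal H^2$ (a union of rectangles, the 1-handles of $\mathcal F$). Assume that $\mathcal F\cap H_0$ is connected for each 0-handle $H_0$. **Curves.** A closed curve $N$ in the boundary of a 0-handle is *admissible* if it is cut into finitely many embedded arcs, its arcs of intersection with $\mathcal F^0$, $\mathcal F^1$ and $\partial\mathcal H^0-\mathcal F\subset\partial M$ (the first and last kind properly embedded), and (i) it respects the product structure of the 1-handles of $\mathcal F$; (ii) it does not lie entirely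 in $\partial M$ or entirely in $\mathcal F^0$; (iii) no arc of $N\cap\mathcal F^0$ has its endpoints in the same component of $\partial\mathcal F^0\cap\mathcal F^1$, in the same component of $\partial\mathcal F^0-\mathcal F^1$, or in adjacent components of these two sets; (iv) no arc of $N$ in $\partial\mathcal H^0-\mathcal F$ has its endpoints in the same component of $\partial\mathcal F^0-\mathcal F^1$. It is *normal* if moreover it is a simple closed curve and meets each 1-handle of $\mathcal F$ and each component of $\partial\mathcal H^0-\mathcal F$ in at most one arc. **Angled spine.** Each 1-handle of $\mathcal F$ is given an exterior angle $\epsilon\in(0,\pi)$ and the interior angle $\pi-\epsilon$. These determine an *angled spine* if the interior angles around each 2-handle of $\mathcal H$ sum to $2\pi$, and every normal curve $N$ has combinatorial area $a(N)=\sum\epsilon_i-2\pi+\pi|N\cap\partial M|\ge 0$, the sum being over the arcs of $N\cap\mathcal F^1$. Here and below $|X|$ is the number of components of $X$. **Admissible surfaces.** Let $F$ be a compact surface, possibly disconnected, mapped continuously into $M$, not necessarily embedded, with only points of $\partial F$ on $\partial M$. ($F\cap X$ denotes the preimage of $X\subset M$ in $F$, and $\partial F-\partial M$ the part of $\partial F$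 not mapped into $\partial M$.) It is *admissible* if * $\partial F$ is disjoint from $\mathcal H^2$, and a component of $\partial F$ that touches $\partial M$ lies in $\partial M$; * $F\cap\mathcal H^i$ is a finite disjoint union of discs, the $i$-handles of $F$. Each 2-handle of $F$ is a parallel copy $D^2\times\{t\}$, $0<t<1$, of the core of a 2-handle. Each 1-handle of $F$ is $D^1\times g$ in a 1-handle $D^1\times D^2$, with $g$ an embedded arc in $D^2$ whose interior lies in the interior of $D^2$, and which ends on $\partial D^2$ (then $D^1$ times that end lies in $\mathcal H^2$ or in $\partial M$) or in the interior of $D^2$ (then $D^1$ times that end is an arc of $\partial F-\partial M$). It meets $\partial F$ only in $D^1\times\partial g$; * each 0-handle $H$ of $F$ has its interior in the interior of a 0-handle and in the interior of $F$. If $H$ does not touch $\partial F-\partial M$, then $\partial H$ is an admissible closed curve. Otherwise $\partial H\cap\partial\mathcal H^0$ is a non-empty collection of arcs satisfying (i)–(iv), except that an arc may lie entirely in $\mathcal F^0$. The remaining arcs of $\partial H$ belong to $\partial F-\partial M$, with interiors off $\partial\mathcal H^0$ and endpoints in the interior of $\mathcal F^0$. The combinatorial area of a 0-handle $H$ of $F$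 is $$a(H)=\sum_i\epsilon_i-2\pi+\pi|H\cap\partial M|+3\pi|\partial H-\partial\mathcal H^0|,$$ where the $\epsilon_i$ are the exterior angles of the 1-handles of $\mathcal F$ over which $\partial H$ runs, counted with multiplicity, and $a(F)$ is the sum of $a(H)$ over the 0-handles $H$ of $F$. **Proposition.** Let $F$ be an admissible surface in a handle structure $\mathcal H$ arising from an angled spine. Let $\mathrm{Length}(\partial F-\partial M)$ be the number of arcs of intersection between $\partial F-\partial M$ and the 1-handles of $\mathcal H$. Then $$a(F)=-2\pi\chi(F)+2\pi\,\mathrm{Length}(\partial F-\partial M),$$ where $\chi(F)$ is the Euler characteristic of $F$, i.e. the alternating sum of the numbers of cells of a finite CW structure on $F$. -/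

import Mathlib

open Set Topology
open scoped Manifold unitInterval

noncomputable section

namespace GaussBonnet

/-! ### Euler characteristic and counting components -/

/-- `χ` is the Euler characteristic of `X`: the alternating sum of the numbers of cells of a
finite CW structure on `X`. -/
def HasEulerChar (X : Type*) [TopologicalSpace X] (χ : ℤ) : Prop :=
  ∃ _ : CWComplex (univ : Set X), CWComplex.Finite (univ : Set X) ∧
    χ = ∑ᶠ n : ℕ, (-1 : ℤ) ^ n * (Nat.card (RelCWComplex.cell (univ : Set X) n) : ℤ)

/-- The number of connected components of a subset. -/
def numComp {X : Type*} [TopologicalSpace X] (S : Set X) : ℕ :=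
  Nat.card (ConnectedComponents S)

/-- The boundary of a 3-manifold. -/
def bdry3 (M : Type*) [TopologicalSpace M] [ChartedSpace (EuclideanHalfSpace 3) M] : Set M :=
  (𝓡∂ 3).boundary M

/-- The boundary of a surface. -/
def bdry2 (F : Type*) [TopologicalSpace F] [ChartedSpace (EuclideanHalfSpace 2) F] : Set F :=
  (𝓡∂ 2).boundary F

/-! ### Model balls -/

/-- The closed unit disc `D²`. -/
abbrev D2 : Type := Metric.closedBall (0 : ℂ) 1

/-- The closed unit ball `D³`. -/
abbrev D3 : Type := Metric.closedBall (0 : EuclideanSpace ℝ (Fin 3)) 1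

/-- The point `exp (2πiθ)` of the boundary circle of `D²`; it has period `1` in `θ`. -/
def rim (θ : ℝ) : D2 := ⟨(Circle.exp (2 * Real.pi * θ) : ℂ), by
  rw [mem_closedBall_zero_iff, Circle.norm_coe]⟩

/-! ### Handle structures -/

/-- A handle structure on `M` with handles of index `0`, `1`, `2`, i.e. the structure obtained by
thickening a spine of `M` (the `i`-cells of the spine are the cores of the `i`-handles).
Handles are `D³`, `D¹ × D²` and `D² × D¹`, with `D¹ = [0,1]`. The 2-handles respect the product
structure of the 1-handles, and each of them touches some 1-handle. The 2-handle with index `k`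
is parametrised so that its attaching circle is cut into `2 * valence k` arcs of equal size, which
lie alternately in 0-handles and in 1-handles. -/
structure HandleStructure (M : Type*) [TopologicalSpace M] where
  I0 : Type
  I1 : Type
  I2 : Type
  [fin0 : Fintype I0]
  [fin1 : Fintype I1]
  [fin2 : Fintype I2]
  h0 : I0 → D3 → M
  h1 : I1 → I × D2 → M
  h2 : I2 → D2 × I → M
  cont0 : ∀ i, Continuous (h0 i)
  cont1 : ∀ i, Continuous (h1 i)
  cont2 : ∀ i, Continuous (h2 i)
  /-- Handles are embedded, and handles of the same index are disjoint. -/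
  inj0 : Function.Injective (fun p : I0 × D3 => h0 p.1 p.2)
  inj1 : Function.Injective (fun p : I1 × (I × D2) => h1 p.1 p.2)
  inj2 : Function.Injective (fun p : I2 × (D2 × I) => h2 p.1 p.2)
  /-- The handles cover `M`. -/
  cover : ∀ x : M, (∃ i y, h0 i y = x) ∨ (∃ i y, h1 i y = x) ∨ (∃ i y, h2 i y = x)
  /-- A 1-handle meets the 0-handles exactly in `∂D¹ × D²`, ... -/
  attach1 : ∀ j p, (∃ i y, h0 i y = h1 j p) ↔ (p.1 = 0 ∨ p.1 = 1)
  /-- ... which is attached to the boundary of the 0-handles. -/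
  attach1_sphere : ∀ j p, (p.1 = 0 ∨ p.1 = 1) → ∃ i, ∃ y : D3,
    ‖(y : EuclideanSpace ℝ (Fin 3))‖ = 1 ∧ h0 i y = h1 j p
  /-- A 2-handle meets the handles of smaller index exactly in `∂D² × D¹`. -/
  attach2 : ∀ k p, ((∃ i y, h0 i y = h2 k p) ∨ (∃ j y, h1 j y = h2 k p)) ↔ ‖(p.1 : ℂ)‖ = 1
  valence : I2 → ℕ
  valence_pos : ∀ k, 0 < valence k
  /-- The even arcs (times `D¹`) lie in the boundary of the 0-handles ... -/
  even_arc : ∀ k (r : Fin (valence k)) (θ : ℝ) (t : I), θ ∈ Icc (2 * (r : ℝ)) (2 * (r : ℝ) + 1) →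
    ∃ i, ∃ y : D3, ‖(y : EuclideanSpace ℝ (Fin 3))‖ = 1 ∧
      h0 i y = h2 k (rim (θ / (2 * valence k)), t)
  /-- ... and meet the 1-handles only in their ends. -/
  even_arc_open : ∀ k (r : Fin (valence k)) (θ : ℝ) (t : I),
    θ ∈ Ioo (2 * (r : ℝ)) (2 * (r : ℝ) + 1) →
    ¬ ∃ j y, h1 j y = h2 k (rim (θ / (2 * valence k)), t)
  /-- The odd arcs (times `D¹`) are of the form `D¹ × (arc in ∂D²)` in a 1-handle, compatibly with
  both product structures. -/
  odd_arc : ∀ k (r : Fin (valence k)), ∃ (j : I1) (b : I → D2), (∀ t, ‖(b t : ℂ)‖ = 1) ∧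
    ((∀ s t : I, h2 k (rim ((2 * (r : ℝ) + 1 + s) / (2 * valence k)), t) = h1 j (s, b t)) ∨
     (∀ s t : I, h2 k (rim ((2 * (r : ℝ) + 1 + s) / (2 * valence k)), t) =
        h1 j (unitInterval.symm s, b t)))
  /-- On the boundary of each 0-handle, the part covered by 1-handles and 2-handles is
  connected. -/
  connected : ∀ i, IsPreconnected
    {x : M | (∃ y : D3, ‖(y : EuclideanSpace ℝ (Fin 3))‖ = 1 ∧ h0 i y = x) ∧
      ((∃ j y, h1 j y = x) ∨ (∃ k y, h2 k y = x))}

attribute [instance] HandleStructure.fin0 HandleStructure.fin1 HandleStructure.fin2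

namespace HandleStructure

variable {M : Type*} [TopologicalSpace M] (H : HandleStructure M)

/-- The union of the 0-handles. -/
def H0 : Set M := {x | ∃ i y, H.h0 i y = x}

/-- The union of the 1-handles. -/
def H1 : Set M := {x | ∃ i y, H.h1 i y = x}

/-- The union of the 2-handles. -/
def H2 : Set M := {x | ∃ i y, H.h2 i y = x}

/-- The boundary sphere of a single 0-handle. -/
def sphere0 (i : H.I0) : Set M :=
  {x | ∃ y : D3, ‖(y : EuclideanSpace ℝ (Fin 3))‖ = 1 ∧ H.h0 i y = x}

/-- The union of the boundary spheres of the 0-handles. -/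
def bdH0 : Set M := ⋃ i, H.sphere0 i

/-- The surface `𝓕 = 𝓗⁰ ∩ (𝓗¹ ∪ 𝓗²)`. -/
def surf : Set M := H.H0 ∩ (H.H1 ∪ H.H2)

/-- The 0-handles `𝓗⁰ ∩ 𝓗¹` of `𝓕`. -/
def F0 : Set M := H.H0 ∩ H.H1

/-- The 1-handles `𝓗⁰ ∩ 𝓗²` of `𝓕`. -/
def F1 : Set M := H.H0 ∩ H.H2

/-- The boundary circles of the discs `𝓕⁰`. -/
def bdF0 : Set M := {x | ∃ j, ∃ p : I × D2, (p.1 = 0 ∨ p.1 = 1) ∧ ‖(p.2 : ℂ)‖ = 1 ∧ H.h1 j p = x}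

/-- The index set of the 1-handles of `𝓕`, that is of the components of `𝓗⁰ ∩ 𝓗²`. -/
abbrev Strip : Type := Σ k : H.I2, Fin (H.valence k)

/-- The fibre over `t` of a 1-handle `D¹ × D¹` of `𝓕`; it runs from `𝓕⁰` to `𝓕⁰`. -/
def core (q : H.Strip) (t : I) : Set M :=
  {x | ∃ θ ∈ Icc (2 * (q.2 : ℝ)) (2 * (q.2 : ℝ) + 1),
    H.h2 q.1 (rim (θ / (2 * H.valence q.1)), t) = x}

/-- A 1-handle of `𝓕`, as a set. -/
def strip (q : H.Strip) : Set M := ⋃ t : I, H.core q t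

/-! ### Normal and admissible curves -/

/-- `x` and `y` lie in the same component of `S`. -/
def SameComp (S : Set M) (x y : M) : Prop := x ∈ S ∧ y ∈ connectedComponentIn S x

/-- `x` lies in a component of `∂𝓕⁰ ∩ 𝓕¹`, and `y` in an adjacent component of `∂𝓕⁰ - 𝓕¹`. -/
def Adjacent (x y : M) : Prop :=
  (connectedComponentIn (H.bdF0 ∩ H.F1) x ∩
    closure (connectedComponentIn (H.bdF0 \ H.F1) y)).Nonempty

end HandleStructure

/-- The kinds of arcs into which the boundary of a 0-handle of a surface is cut: arcs in `𝓕⁰`, in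
`𝓕¹`, in `∂𝓗⁰ - 𝓕 ⊆ ∂M`, and arcs of `∂F - ∂M`, whose interior is disjoint from `∂𝓗⁰`. -/
inductive Piece
  | zero
  | one
  | outer
  | free

namespace HandleStructure

variable {M : Type*} [TopologicalSpace M] [ChartedSpace (EuclideanHalfSpace 3) M]
  (H : HandleStructure M)

/-- The restriction of the path `γ` to `[a, b]` is an admissible arc of the given kind. -/
def IsPiece (γ : ℝ → M) (a b : ℝ) : Piece → Prop
  | .zero =>
      -- an embedded arc, properly embedded in `𝓕⁰` except where it ends at `∂F - ∂M`,
      -- and satisfying the condition on its endpoints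
      (∀ θ ∈ Icc a b, γ θ ∈ H.F0) ∧ (∀ θ ∈ Ioo a b, γ θ ∉ H.bdF0) ∧ InjOn γ (Icc a b) ∧
      ¬ SameComp (H.bdF0 ∩ H.F1) (γ a) (γ b) ∧ ¬ SameComp (H.bdF0 \ H.F1) (γ a) (γ b) ∧
      ¬ H.Adjacent (γ a) (γ b) ∧ ¬ H.Adjacent (γ b) (γ a)
  | .one =>
      -- an embedded arc respecting the product structure of a 1-handle of `𝓕`
      InjOn γ (Icc a b) ∧ ∃ (q : H.Strip) (t : I), 0 < t ∧ t < 1 ∧ γ '' Icc a b = H.core q t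
  | .outer =>
      -- an embedded arc, properly embedded in (the closure of) `∂𝓗⁰ - 𝓕`, whose endpoints lie in
      -- different components of `∂𝓕⁰ - 𝓕¹`
      (∀ θ ∈ Icc a b, γ θ ∈ H.bdH0 ∩ bdry3 M) ∧ (∀ θ ∈ Ioo a b, γ θ ∉ H.surf) ∧
      InjOn γ (Icc a b) ∧ γ a ∈ H.bdF0 \ H.F1 ∧ γ b ∈ H.bdF0 \ H.F1 ∧
      ¬ SameComp (H.bdF0 \ H.F1) (γ a) (γ b)
  | .free =>
      -- an arc in the interior of the 0-handles, with its endpoints in the interior of `𝓕⁰`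
      (∀ θ ∈ Ioo a b, γ θ ∈ H.H0 \ H.bdH0) ∧ γ a ∈ H.F0 \ H.bdF0 ∧ γ b ∈ H.F0 \ H.bdF0

/-- The loop `γ` (of period 1) is cut at the points `j / n` into maximal arcs of the given kinds:
each of these is an admissible arc, and consecutive arcs have different kinds. In particular the
loop does not lie entirely in `∂M` or entirely in `𝓕⁰`. -/
def IsSubdivided (γ : ℝ → M) (n : ℕ) (kind : ZMod n → Piece) : Prop :=
  0 < n ∧ ∀ j : ℕ, H.IsPiece γ (j / n) ((j + 1) / n) (kind j) ∧
    kind (j : ZMod n) ≠ kind ((j + 1 : ℕ) : ZMod n)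

/-- A closed curve in the boundary of a 0-handle, admissible: no embeddedness of the whole curve,
and any number of arcs in each 1-handle of `𝓕` and in each component of `∂𝓗⁰ - 𝓕`. -/
def IsAdmissibleLoop (γ : ℝ → M) : Prop :=
  Continuous γ ∧ Function.Periodic γ 1 ∧ (∃ i, ∀ θ, γ θ ∈ H.sphere0 i) ∧
    ∃ (n : ℕ) (kind : ZMod n → Piece), H.IsSubdivided γ n kind ∧ ∀ j, kind j ≠ .free

/-- A normal curve in the boundary of a 0-handle: an admissible simple closed curve which meets
each 1-handle of `𝓕`, and each component of `∂𝓗⁰ - 𝓕`, in at most one arc. -/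
def IsNormalCurve (N : Set M) : Prop :=
  ∃ γ : ℝ → M, H.IsAdmissibleLoop γ ∧ InjOn γ (Ico 0 1) ∧ N = range γ ∧
    (∀ q, IsPreconnected (N ∩ H.strip q)) ∧
    (∀ x ∈ H.bdH0 \ H.surf, IsPreconnected (N ∩ connectedComponentIn (H.bdH0 \ H.surf) x))

/-- The combinatorial area of a normal curve, for the exterior angles `ε`. -/
def curveArea (ε : H.Strip → ℝ) (N : Set M) : ℝ :=
  (∑ q : H.Strip, ε q * numComp (N ∩ H.strip q)) - 2 * Real.pi
    + Real.pi * numComp (N ∩ bdry3 M)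

/-- The exterior angles `ε` (with interior angles `π - ε`) determine an angled spine. -/
structure IsAngledSpine (ε : H.Strip → ℝ) : Prop where
  pos : ∀ q, 0 < ε q
  lt_pi : ∀ q, ε q < Real.pi
  area_nonneg : ∀ N, H.IsNormalCurve N → 0 ≤ H.curveArea ε N
  interior_sum : ∀ k : H.I2, ∑ r : Fin (H.valence k), (Real.pi - ε ⟨k, r⟩) = 2 * Real.pi

end HandleStructure

/-! ### Admissible surfaces -/

/-- An admissible surface in the handle structure `H`: a map `f` of a surface `F` into `M`, not
necessarily an embedding, such that the preimage of the `i`-handles of `M` is a finite disjoint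
union of discs, the `i`-handles of `F`, in standard position. -/
structure AdmissibleSurface {M : Type*} [TopologicalSpace M]
    [ChartedSpace (EuclideanHalfSpace 3) M] (H : HandleStructure M)
    (F : Type*) [TopologicalSpace F] [ChartedSpace (EuclideanHalfSpace 2) F] where
  f : F → M
  cont : Continuous f
  /-- Only boundary points of `F` lie on `∂M`. -/
  proper : ∀ x, f x ∈ bdry3 M → x ∈ bdry2 F
  /-- The boundary of `F` is disjoint from the 2-handles. -/
  bdry_two : ∀ x ∈ bdry2 F, f x ∉ H.H2
  /-- A component of `∂F` that touches `∂M` lies in `∂M`. -/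
  bdry_comp : ∀ x ∈ bdry2 F, f x ∈ bdry3 M → ∀ y ∈ connectedComponentIn (bdry2 F) x,
    f y ∈ bdry3 M
  K0 : Type
  K1 : Type
  K2 : Type
  [finK0 : Fintype K0]
  [finK1 : Fintype K1]
  [finK2 : Fintype K2]
  /-- The handles of `F`. -/
  e0 : K0 → D2 → F
  e1 : K1 → I × I → F
  e2 : K2 → D2 → F
  econt0 : ∀ c, Continuous (e0 c)
  econt1 : ∀ c, Continuous (e1 c)
  econt2 : ∀ c, Continuous (e2 c)
  einj0 : Function.Injective (fun p : K0 × D2 => e0 p.1 p.2)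
  einj1 : Function.Injective (fun p : K1 × (I × I) => e1 p.1 p.2)
  einj2 : Function.Injective (fun p : K2 × D2 => e2 p.1 p.2)
  preim0 : ∀ x, f x ∈ H.H0 ↔ ∃ c y, e0 c y = x
  preim1 : ∀ x, f x ∈ H.H1 ↔ ∃ c y, e1 c y = x
  preim2 : ∀ x, f x ∈ H.H2 ↔ ∃ c y, e2 c y = x
  /-- A 2-handle of `F` is a parallel copy of the core of a 2-handle of `M`. -/
  two_handle : ∀ c, ∃ (k : H.I2) (t : I), 0 < t ∧ t < 1 ∧ ∀ x, f (e2 c x) = H.h2 k (x, t)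
  /-- A 1-handle of `F` is of the form `D¹ × g` in a 1-handle `D¹ × D²` of `M`, for an embedded
  arc `g` in `D²`. It can meet `∂F` only in `D¹ × ∂g`. For each end of `g`, either the end lies on
  `∂D²` and gives an arc in the 2-handles or an arc in `∂M`, or it is in the interior of `D²` and
  gives an arc of `∂F - ∂M`. -/
  one_handle : ∀ c, ∃ (j : H.I1) (g : I → D2), Continuous g ∧ Function.Injective g ∧
    (∀ s t, f (e1 c (s, t)) = H.h1 j (s, g t)) ∧
    (∀ s t : I, 0 < t → t < 1 → ‖(g t : ℂ)‖ < 1 ∧ e1 c (s, t) ∉ bdry2 F) ∧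
    ∀ t : I, t = 0 ∨ t = 1 →
      (‖(g t : ℂ)‖ = 1 ∧
        ((∀ s, f (e1 c (s, t)) ∈ H.H2) ∨ (∀ s, f (e1 c (s, t)) ∈ bdry3 M))) ∨
      (‖(g t : ℂ)‖ < 1 ∧ ∀ s, e1 c (s, t) ∈ bdry2 F ∧ f (e1 c (s, t)) ∉ bdry3 M)
  /-- The interior of a 0-handle of `F` lies in the interior of `F` and of a 0-handle of `M`. -/
  zero_handle : ∀ c, ∃ i : H.I0, ∀ x : D2, ‖(x : ℂ)‖ < 1 → e0 c x ∉ bdry2 F ∧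
    ∃ y : D3, ‖(y : EuclideanSpace ℝ (Fin 3))‖ < 1 ∧ f (e0 c x) = H.h0 i y
  /-- The boundary of a 0-handle of `F` is cut into admissible arcs; it is an admissible closed
  curve if the 0-handle does not touch `∂F - ∂M`, and otherwise its arcs that leave `∂𝓗⁰` are
  arcs of `∂F - ∂M`. -/
  zero_boundary : ∀ c, ∃ (n : ℕ) (kind : ZMod n → Piece),
    H.IsSubdivided (fun θ => f (e0 c (rim θ))) n kind ∧
    ∀ j : ℕ, kind j = .free → ∀ θ ∈ Icc ((j : ℝ) / n) ((j + 1) / n),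
      e0 c (rim θ) ∈ bdry2 F ∧ f (e0 c (rim θ)) ∉ bdry3 M

attribute [instance] AdmissibleSurface.finK0 AdmissibleSurface.finK1 AdmissibleSurface.finK2

namespace AdmissibleSurface

variable {M : Type*} [TopologicalSpace M] [ChartedSpace (EuclideanHalfSpace 3) M]
  {H : HandleStructure M} {F : Type*} [TopologicalSpace F]
  [ChartedSpace (EuclideanHalfSpace 2) F] (S : AdmissibleSurface H F)

/-- The 0-handle of `F` with index `c`, as a subset of `F`. -/
def disc (c : S.K0) : Set F := range (S.e0 c)

/-- The boundary circle of a 0-handle of `F`. -/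
def circle (c : S.K0) : Set F := {x | ∃ y : D2, ‖(y : ℂ)‖ = 1 ∧ S.e0 c y = x}

/-- The combinatorial area of a 0-handle of `F`. All intersections are counted on `F`, hence with
multiplicity. -/
def handleArea (ε : H.Strip → ℝ) (c : S.K0) : ℝ :=
  (∑ q : H.Strip, ε q * numComp (S.circle c ∩ S.f ⁻¹' H.strip q)) - 2 * Real.pi
    + Real.pi * numComp (S.disc c ∩ S.f ⁻¹' bdry3 M)
    + 3 * Real.pi * numComp (S.circle c \ S.f ⁻¹' H.bdH0)

/-- The combinatorial area of `F`. -/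
def area (ε : H.Strip → ℝ) : ℝ := ∑ c : S.K0, S.handleArea ε c

/-- The number of arcs of intersection between `∂F - ∂M` and the 1-handles of `M`. -/
def length : ℕ := numComp ((bdry2 F \ S.f ⁻¹' bdry3 M) ∩ S.f ⁻¹' H.H1)

end AdmissibleSurface

end GaussBonnet

end

/-! The handles of `F` give a cell structure. The boundary circle of each 0-handle is cut into arcs,
which alternate between arcs in `𝓕⁰` (kind `zero`) and arcs of the other kinds: ends of `one` arcs
lie in `∂𝓕⁰ ∩ 𝓕¹`, ends of `outer` arcs in `∂𝓕⁰ - 𝓕¹`, ends of `free` arcs in the interior of `𝓕⁰`,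
so two of these cannot follow each other without being of one kind, which maximality of the arcs
forbids (`kind_next_eq_zero_iff`).

The preimage of `𝓕⁰` in `F` is a disjoint union of arcs in two ways: the `zero` arcs, and the ends
`∂D¹ × g` of the 1-handles. Both are its components, so they agree, and the starting points of all
arcs are exactly the corners of the 1-handles (`range_corner`). With K0, K1, K2 the numbers of
handles of `F`, there are therefore 4 K1 arcs. Taking these points as vertices, the arcs and the 2
K1 sides `D¹ × ∂g` as edges and the handles as faces gives χ(F) = 4 K1 - (4 K1 + 2 K1) + (K0 + K1 +
K2) = K0 - K1 + K2 (`hasEulerChar`).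

For the area, a 2-handle of `F` runs once over each strip of the 2-handle of `M` containing it.
Interior angles there sum to 2π, so the exterior angles contribute π(#one) - 2π K2 in total
(`sum_exterior_angles`), and a(F) = π(#one + #outer + 3 #free) - 2π K2 - 2π K0. Alternation gives
#one + #outer + #free = 2 K1, and counting the corners in the interior of `𝓕⁰` in two ways gives
#free = Length (`length_eq_count_free`). Of the weight 3π of a free arc, π enters the count of 2 K1
and 2π the length term. -/

noncomputable section

namespace GaussBonnet

/-! ### Components of finite disjoint unions -/

section Components

variable {X ι : Type*} [TopologicalSpace X] [Finite ι] {S : Set X} {A C : ι → Set X}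

/-- Each piece is relatively closed, and its complement in `S` is the finite union of the others.
The pieces are only traces of closed sets, so that open arcs are allowed too. -/
theorem isClopen_preimage_of_finite_cover (hC : ∀ i, IsClosed (C i)) (hA : ∀ i, S ∩ C i = A i)
    (hdisj : ∀ i j x, x ∈ A i → x ∈ A j → i = j) (hS : ∀ x ∈ S, ∃ i, x ∈ A i) (i : ι) :
    IsClopen ((↑) ⁻¹' A i : Set S) := by
  have hcl : ∀ i, IsClosed ((↑) ⁻¹' A i : Set S) := fun i => by
    have : ((↑) ⁻¹' A i : Set S) = (↑) ⁻¹' C i := by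
      ext x
      simp [← hA i]
    rw [this]
    exact (hC i).preimage continuous_subtype_val
  refine ⟨hcl i, ?_⟩
  have : ((↑) ⁻¹' A i : Set S) = (⋃ j : {j // j ≠ i}, (↑) ⁻¹' A j.1)ᶜ := by
    ext x
    simp only [mem_preimage, mem_compl_iff, mem_iUnion, not_exists, Subtype.forall]
    constructor
    · exact fun hx j hj hxj => hj (hdisj _ _ _ hxj hx)
    · intro h
      obtain ⟨j, hj⟩ := hS x x.2
      by_cases hji : j = i
      · exact hji ▸ hj
      · exact absurd hj (h j hji)
  rw [this]
  exact (isClosed_iUnion_of_finite fun j => hcl _).isOpen_compl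

/-- A finite disjoint union of nonempty, connected, relatively closed sets has these sets as its
components. -/
theorem numComp_eq_card (hC : ∀ i, IsClosed (C i)) (hA : ∀ i, S ∩ C i = A i)
    (hdisj : ∀ i j x, x ∈ A i → x ∈ A j → i = j) (hS : ∀ x ∈ S, ∃ i, x ∈ A i)
    (hconn : ∀ i, IsConnected (A i)) : numComp S = Nat.card ι := by
  refine Nat.card_congr (ConnectedComponents.equivOfIsClopenOfIsConnected
    (U := fun i => ((↑) ⁻¹' A i : Set S))
    (isClopen_preimage_of_finite_cover hC hA hdisj hS) ?_ ?_ fun i => ?_)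
  · intro i j hij
    exact Set.disjoint_left.2 fun x hi hj => hij (hdisj _ _ _ hi hj)
  · exact iUnion_eq_univ_iff.2 fun x => hS x x.2
  · have hsub : A i ⊆ S := by rw [← hA i]; exact inter_subset_left
    obtain ⟨x, hx⟩ := (hconn i).nonempty
    refine ⟨⟨⟨x, hsub hx⟩, hx⟩, Topology.IsInducing.subtypeVal.isPreconnected_image.1 ?_⟩
    rw [Subtype.image_preimage_coe, inter_eq_right.2 hsub]
    exact (hconn i).isPreconnected

/-- This serves to compare two decompositions of the same set: pieces that share a point are both
the component of that point, hence equal. -/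
theorem connectedComponentIn_eq_of_finite_cover (hC : ∀ i, IsClosed (C i))
    (hA : ∀ i, S ∩ C i = A i)
    (hdisj : ∀ i j x, x ∈ A i → x ∈ A j → i = j) (hS : ∀ x ∈ S, ∃ i, x ∈ A i)
    (hconn : ∀ i, IsConnected (A i)) {i : ι} {x : X} (hx : x ∈ A i) :
    connectedComponentIn S x = A i := by
  have hsub : A i ⊆ S := by rw [← hA i]; exact inter_subset_left
  refine Subset.antisymm ?_ ((hconn i).isPreconnected.subset_connectedComponentIn hx hsub)
  rw [connectedComponentIn_eq_image (hsub hx)]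
  rintro _ ⟨y, hy, rfl⟩
  exact (isClopen_preimage_of_finite_cover hC hA hdisj hS i).connectedComponent_subset hx hy

/-- The components of a finite disjoint union of arcs are these arcs. -/
theorem numComp_eq_card_of_arcs [T2Space X] {γ : ι → I → X} (hγ : ∀ i, Continuous (γ i))
    (hdisj : ∀ i j x, x ∈ range (γ i) → x ∈ range (γ j) → i = j)
    (hS : ∀ x, x ∈ S ↔ ∃ i, x ∈ range (γ i)) : numComp S = Nat.card ι :=
  numComp_eq_card (C := fun i => range (γ i)) (fun i => (isCompact_range (hγ i)).isClosed)
    (fun i => inter_eq_right.2 fun x hx => (hS x).2 ⟨i, hx⟩) hdisj (fun x hx => (hS x).1 hx)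
    (fun i => isConnected_range (hγ i))

theorem connectedComponentIn_eq_range_of_arcs [T2Space X] {γ : ι → I → X}
    (hγ : ∀ i, Continuous (γ i)) (hdisj : ∀ i j x, x ∈ range (γ i) → x ∈ range (γ j) → i = j)
    (hS : ∀ x, x ∈ S ↔ ∃ i, x ∈ range (γ i)) {i : ι} {x : X} (hx : x ∈ range (γ i)) :
    connectedComponentIn S x = range (γ i) :=
  connectedComponentIn_eq_of_finite_cover (C := fun i => range (γ i))
    (fun i => (isCompact_range (hγ i)).isClosed)
    (fun i => inter_eq_right.2 fun x hx => (hS x).2 ⟨i, hx⟩) hdisj (fun x hx => (hS x).1 hx)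
    (fun i => isConnected_range (hγ i)) hx

end Components

/-! ### Arcs -/

/-- The change of parameter `δ⁻¹ ∘ γ` is a continuous bijection of the interval, hence strictly
monotone or antitone, so it fixes or exchanges the end points. -/
theorem arc_ends_eq {X : Type*} [TopologicalSpace X] [T2Space X] {γ δ : I → X}
    (hγ : Continuous γ) (hδ : Continuous δ) (iγ : Function.Injective γ)
    (iδ : Function.Injective δ) (h : range γ = range δ) :
    (γ 0 = δ 0 ∧ γ 1 = δ 1) ∨ (γ 0 = δ 1 ∧ γ 1 = δ 0) := by
  have hemb := (hδ.isClosedEmbedding iδ).isEmbedding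
  have hex : ∀ s, ∃ t, δ t = γ s := fun s => by
    have : γ s ∈ range δ := h ▸ mem_range_self s
    exact this
  choose φ hφ using hex
  have hφc : Continuous φ := hemb.continuous_iff.2 (by
    have : δ ∘ φ = γ := funext hφ
    rwa [this])
  have hφi : Function.Injective φ := fun s t hst => iγ (by rw [← hφ, ← hφ, hst])
  have hφs : Function.Surjective φ := fun t => by
    obtain ⟨s, hs⟩ : δ t ∈ range γ := h ▸ mem_range_self t
    exact ⟨s, iδ (by rw [hφ, hs])⟩
  obtain ⟨s0, h0⟩ := hφs 0
  obtain ⟨s1, h1⟩ := hφs 1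
  have hl : ∀ x : I, (0 : I) ≤ x := fun x => unitInterval.nonneg x
  have hu : ∀ x : I, x ≤ (1 : I) := fun x => unitInterval.le_one x
  rcases hφc.strictMono_of_inj hφi with hm | hm
  · left
    have e0 : φ 0 = 0 := le_antisymm ((hm.monotone (hl s0)).trans_eq h0) (hl _)
    have e1 : φ 1 = 1 := le_antisymm (hu _) (h1.symm.trans_le (hm.monotone (hu s1)))
    rw [← hφ, ← hφ, e0, e1]
    exact ⟨rfl, rfl⟩
  · right
    have e0 : φ 1 = 0 := le_antisymm ((hm.antitone (hu s0)).trans_eq h0) (hl _)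
    have e1 : φ 0 = 1 := le_antisymm (hu _) (h1.symm.trans_le (hm.antitone (hl s1)))
    rw [← hφ, ← hφ, e0, e1]
    exact ⟨rfl, rfl⟩

/-! ### The boundary circle of the disc -/

theorem continuous_rim : Continuous rim := by
  unfold rim
  fun_prop

theorem norm_rim (θ : ℝ) : ‖(rim θ : ℂ)‖ = 1 := Circle.norm_coe _

theorem rim_eq_rim_iff {θ θ' : ℝ} : rim θ = rim θ' ↔ ∃ m : ℤ, θ = θ' + m := by
  have : rim θ = rim θ' ↔ Circle.exp (2 * Real.pi * θ) = Circle.exp (2 * Real.pi * θ') := by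
    rw [Subtype.ext_iff, Circle.ext_iff]
    rfl
  rw [this, Circle.exp_eq_exp]
  refine exists_congr fun m => ?_
  have := Real.pi_pos
  constructor <;> intro h
  · have : 2 * Real.pi * (θ - (θ' + m)) = 0 := by linear_combination h
    have : θ - (θ' + m) = 0 := by simpa [Real.pi_ne_zero] using this
    linarith
  · rw [h]; ring

theorem rim_injOn {a θ θ' : ℝ} (h : θ ∈ Ico a (a + 1)) (h' : θ' ∈ Ico a (a + 1))
    (e : rim θ = rim θ') : θ = θ' := by
  obtain ⟨m, hm⟩ := rim_eq_rim_iff.1 e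
  have h1 : (m : ℝ) < 1 := by linarith [h.2, h'.1]
  have h2 : (-1 : ℝ) < m := by linarith [h.1, h'.2]
  have : m = 0 := by
    have h1' : m < 1 := by exact_mod_cast h1
    have h2' : -1 < m := by exact_mod_cast h2
    omega
  simpa [this] using hm

theorem exists_rim_eq {y : D2} (hy : ‖(y : ℂ)‖ = 1) : ∃ θ, rim θ = y := by
  obtain ⟨t, ht⟩ := Complex.norm_eq_one_iff _ |>.1 hy
  refine ⟨t / (2 * Real.pi), Subtype.ext ?_⟩
  simp only [rim, Circle.coe_exp]
  rw [← ht]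
  congr 2
  have := Real.pi_pos
  push_cast
  field_simp

/-! ### Finite CW structures -/

section Cells

universe u

/-- Injectivity on the closed balls makes every characteristic map an embedding, by compactness, so
the inverses on open cells are continuous. Finiteness of the family removes any further condition on
the topology. -/
theorem hasEulerChar_of_family {X : Type u} [TopologicalSpace X] [T2Space X] {ι : Type}
    [Fintype ι] (d : ι → ℕ) (φ : ∀ i, (Fin (d i) → ℝ) → X)
    (hcont : ∀ i, ContinuousOn (φ i) (Metric.closedBall 0 1))
    (hinj : ∀ i, InjOn (φ i) (Metric.closedBall 0 1))
    (hdisj : ∀ i j, ∀ x ∈ Metric.ball 0 1, ∀ y ∈ Metric.ball 0 1, φ i x = φ j y → i = j)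
    (hbd : ∀ i, ∀ x ∈ Metric.sphere 0 1, ∃ j, d j < d i ∧ ∃ y ∈ Metric.closedBall 0 1,
      φ j y = φ i x)
    (hcov : ∀ x, ∃ i, ∃ y ∈ Metric.closedBall 0 1, φ i y = x) :
    HasEulerChar X (∑ i, (-1) ^ d i) := by
  classical
  have hinj' : ∀ i, InjOn (φ i) (Metric.ball 0 1) := fun i =>
    (hinj i).mono Metric.ball_subset_closedBall
  let E : ∀ i, PartialEquiv (Fin (d i) → ℝ) X := fun i =>
    InjOn.toPartialEquiv (φ i) (Metric.ball 0 1) (hinj' i)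
  have hE : ∀ i, ContinuousOn (E i).symm (E i).target := by
    intro i
    have hemb : IsEmbedding ((Metric.closedBall (0 : Fin (d i) → ℝ) 1).domRestrict (φ i)) :=
      have : CompactSpace (Metric.closedBall (0 : Fin (d i) → ℝ) 1) :=
        isCompact_iff_compactSpace.1 (isCompact_closedBall _ _)
      ((continuousOn_iff_continuous_domRestrict.1 (hcont i)).isClosedEmbedding
        (injOn_iff_injective.1 (hinj i))).isEmbedding
    rw [continuousOn_iff_continuous_domRestrict]
    let g : (E i).target → Metric.closedBall (0 : Fin (d i) → ℝ) 1 := fun y =>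
      ⟨(E i).symm y, Metric.ball_subset_closedBall ((E i).map_target y.2)⟩
    have hg : Continuous g := hemb.continuous_iff.2 (by
      have : (Metric.closedBall (0 : Fin (d i) → ℝ) 1).domRestrict (φ i) ∘ g = (↑) :=
        funext fun y => (E i).right_inv y.2
      rw [this]
      exact continuous_subtype_val)
    exact continuous_subtype_val.comp hg
  -- The cells of a CW structure on `X` are indexed in the universe of `X`, whence the lift.
  let cell : ℕ → Type u := fun n => ULift {i // d i = n}
  let map : ∀ n, cell n → PartialEquiv (Fin n → ℝ) X := fun n c =>
    match n, c with
    | _, ⟨⟨i, rfl⟩⟩ => E i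
  have hev : ∀ᶠ n in Filter.atTop, IsEmpty (cell n) := by
    refine Filter.eventually_atTop.2 ⟨(∑ i, d i) + 1, fun n hn => ⟨?_⟩⟩
    rintro ⟨⟨i, rfl⟩⟩
    have := Finset.single_le_sum (f := d) (fun _ _ => Nat.zero_le _) (Finset.mem_univ i)
    omega
  have hfin : ∀ n, Finite (cell n) := fun n => inferInstance
  have hsrc : ∀ n (i : cell n), (map n i).source = Metric.ball 0 1 := by
    rintro _ ⟨⟨i, rfl⟩⟩; rfl
  have hco : ∀ n (i : cell n), ContinuousOn (map n i) (Metric.closedBall 0 1) := by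
    rintro _ ⟨⟨i, rfl⟩⟩; exact hcont i
  have hcs : ∀ n (i : cell n), ContinuousOn (map n i).symm (map n i).target := by
    rintro _ ⟨⟨i, rfl⟩⟩; exact hE i
  have hpd : (univ : Set (Σ n, cell n)).PairwiseDisjoint
      (fun ni => map ni.1 ni.2 '' Metric.ball 0 1) := by
    rintro ⟨_, ⟨⟨i, rfl⟩⟩⟩ - ⟨_, ⟨⟨j, rfl⟩⟩⟩ - hij
    refine Set.disjoint_left.2 ?_
    rintro _ ⟨x, hx, rfl⟩ ⟨y, hy, hxy⟩
    obtain rfl := hdisj _ _ _ hy _ hx hxy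
    exact hij rfl
  have hmt : ∀ n (i : cell n), MapsTo (map n i) (Metric.sphere 0 1)
      (⋃ (m < n) (j : cell m), map m j '' Metric.closedBall 0 1) := by
    rintro _ ⟨⟨i, rfl⟩⟩ x hx
    obtain ⟨j, hj, y, hy, e⟩ := hbd i x hx
    simp only [mem_iUnion]
    exact ⟨d j, hj, ⟨⟨j, rfl⟩⟩, y, hy, e⟩
  have hun : ⋃ (n : ℕ) (j : cell n), map n j '' Metric.closedBall 0 1 = univ := by
    refine eq_univ_of_forall fun x => ?_
    obtain ⟨i, y, hy, e⟩ := hcov x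
    simp only [mem_iUnion]
    exact ⟨d i, ⟨⟨i, rfl⟩⟩, y, hy, e⟩
  refine ⟨CWComplex.mkFinite univ cell map hev hfin hsrc hco hcs hpd hmt hun,
    CWComplex.finite_mkFinite univ cell map hev hfin hsrc hco hcs hpd hmt hun, ?_⟩
  · have hcard : ∀ n, Nat.card (cell n) = (Finset.univ.filter fun i => d i = n).card := fun n => by
      rw [Nat.card_congr Equiv.ulift, Nat.card_eq_fintype_card, Fintype.card_subtype]
    change _ = ∑ᶠ n : ℕ, (-1 : ℤ) ^ n * (Nat.card (cell n) : ℤ)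
    simp_rw [hcard]
    rw [finsum_eq_sum_of_support_subset (s := Finset.univ.image d),
      Finset.sum_comp (fun n => (-1 : ℤ) ^ n) d]
    · exact Finset.sum_congr rfl fun n _ => by rw [nsmul_eq_mul, mul_comm]
    · intro n hn
      by_contra hn'
      refine hn ?_
      have : (Finset.univ.filter fun i => d i = n) = ∅ := by
        refine Finset.filter_eq_empty_iff.2 fun i _ hi => hn' ?_
        simp [← hi]
      simp [this]

/-- A bounded convex set with nonempty interior is carried to the unit ball by a homeomorphism of
the plane that respects interior and closure. This turns the round 0- and 2-handles into square
cells. -/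
theorem exists_square_homeo_disc : ∃ h : I × I ≃ₜ D2,
    ∀ p : I × I, ‖(h p : ℂ)‖ < 1 ↔ p.1 ∈ Ioo 0 1 ∧ p.2 ∈ Ioo 0 1 := by
  let s : Set ℂ := Icc (0 : ℝ) 1 ×ℂ Icc (0 : ℝ) 1
  have hcl : IsClosed s := isClosed_Icc.reProdIm isClosed_Icc
  have hint : interior s = Ioo (0 : ℝ) 1 ×ℂ Ioo (0 : ℝ) 1 := by
    rw [Complex.interior_reProdIm, interior_Icc]
  have hconv : Convex ℝ s := by
    exact ((convex_Icc (0 : ℝ) 1).is_linear_preimage Complex.reLm.isLinear).inter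
      ((convex_Icc (0 : ℝ) 1).is_linear_preimage Complex.imLm.isLinear)
  have hne : (interior s).Nonempty := by
    refine ⟨⟨1 / 2, 1 / 2⟩, ?_⟩
    rw [hint, Complex.mem_reProdIm]
    norm_num
  have hb : Bornology.IsBounded s :=
    (Metric.isBounded_Icc (0 : ℝ) 1).reProdIm (Metric.isBounded_Icc (0 : ℝ) 1)
  obtain ⟨h, hi, hc, -⟩ :=
    exists_homeomorph_image_interior_closure_frontier_eq_unitBall hconv hne hb
  rw [hcl.closure_eq] at hc
  let z : I × I → ℂ := fun p => ⟨p.1, p.2⟩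
  have hz : ∀ p, z p ∈ s := fun p => ⟨p.1.2, p.2.2⟩
  have hzc : Continuous z := by
    have : z = fun p => ((p.1 : ℝ) : ℂ) + ((p.2 : ℝ) : ℂ) * Complex.I := by
      funext p
      apply Complex.ext <;> simp [z]
    rw [this]
    fun_prop
  let g : I × I → D2 := fun p => ⟨h (z p), hc ▸ mem_image_of_mem h (hz p)⟩
  have hg : Continuous g := (h.continuous.comp hzc).subtype_mk _
  have hbij : Function.Bijective g := by
    constructor
    · intro p q hpq
      have : z p = z q := h.injective (Subtype.ext_iff.1 hpq)
      have h1 := congrArg Complex.re this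
      have h2 := congrArg Complex.im this
      exact Prod.ext (Subtype.ext h1) (Subtype.ext h2)
    · rintro ⟨y, hy⟩
      rw [← hc] at hy
      obtain ⟨w, hw, rfl⟩ := hy
      exact ⟨(⟨w.re, hw.1⟩, ⟨w.im, hw.2⟩), Subtype.ext rfl⟩
  refine ⟨Continuous.homeoOfEquivCompactToT2 (f := Equiv.ofBijective g hbij) hg, fun p => ?_⟩
  change ‖h (z p)‖ < 1 ↔ _
  rw [← mem_ball_zero_iff, ← hi, h.injective.mem_set_image, hint, Complex.mem_reProdIm]
  rfl

/-- A decomposition into points, open arcs and open squares, the boundaries of which consist of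
cells of smaller dimension. -/
theorem hasEulerChar_of_cells {X : Type u} [TopologicalSpace X] [T2Space X] {ι₀ ι₁ ι₂ : Type}
    [Fintype ι₀] [Fintype ι₁] [Fintype ι₂] (p : ι₀ → X) (φ : ι₁ → I → X) (ψ : ι₂ → I × I → X)
    (hφ : ∀ i, Continuous (φ i)) (hψ : ∀ i, Continuous (ψ i))
    (iφ : ∀ i, Function.Injective (φ i)) (iψ : ∀ i, Function.Injective (ψ i))
    (d00 : Function.Injective p)
    (d01 : ∀ i j, ∀ t ∈ Ioo (0 : I) 1, p i ≠ φ j t)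
    (d02 : ∀ i j, ∀ q : I × I, q.1 ∈ Ioo 0 1 → q.2 ∈ Ioo 0 1 → p i ≠ ψ j q)
    (d11 : ∀ i j, ∀ t ∈ Ioo (0 : I) 1, ∀ s ∈ Ioo (0 : I) 1, φ i t = φ j s → i = j)
    (d12 : ∀ i j, ∀ t ∈ Ioo (0 : I) 1, ∀ q : I × I, q.1 ∈ Ioo 0 1 → q.2 ∈ Ioo 0 1 → φ i t ≠ ψ j q)
    (d22 : ∀ i j, ∀ q : I × I, q.1 ∈ Ioo 0 1 → q.2 ∈ Ioo 0 1 →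
      ∀ q' : I × I, q'.1 ∈ Ioo 0 1 → q'.2 ∈ Ioo 0 1 → ψ i q = ψ j q' → i = j)
    (b1 : ∀ i t, t = 0 ∨ t = 1 → φ i t ∈ range p)
    (b2 : ∀ i, ∀ q : I × I, ¬ (q.1 ∈ Ioo 0 1 ∧ q.2 ∈ Ioo 0 1) → ∃ j t, φ j t = ψ i q)
    (hcov : ∀ x, ∃ i q, ψ i q = x) :
    HasEulerChar X (Fintype.card ι₀ - Fintype.card ι₁ + Fintype.card ι₂) := by
  -- In the sup norm the closed unit ball of `Fin n → ℝ` is the cube with sides `[-1, 1]`; `u`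
  -- rescales each side to `[0, 1]`.
  let u : ℝ → I := fun x => projIcc 0 1 zero_le_one ((x + 1) / 2)
  have hu : Continuous u := continuous_projIcc.comp (by fun_prop)
  have uval : ∀ x ∈ Icc (-1 : ℝ) 1, (u x : ℝ) = (x + 1) / 2 := fun x hx => by
    simp only [u]
    rw [projIcc_of_mem]
    constructor <;> linarith [hx.1, hx.2]
  have uinj : ∀ x ∈ Icc (-1 : ℝ) 1, ∀ y ∈ Icc (-1 : ℝ) 1, u x = u y → x = y := fun x hx y hy h => by
    have := congrArg Subtype.val h
    rw [uval x hx, uval y hy] at this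
    linarith
  have uIoo : ∀ x ∈ Icc (-1 : ℝ) 1, u x ∈ Ioo (0 : I) 1 ↔ x ∈ Ioo (-1 : ℝ) 1 := fun x hx => by
    rw [mem_Ioo, mem_Ioo, ← Subtype.coe_lt_coe, ← Subtype.coe_lt_coe, uval x hx, Icc.coe_zero,
      Icc.coe_one]
    constructor <;> rintro ⟨h1, h2⟩ <;> constructor <;> linarith
  have usurj : ∀ t : I, ∃ x ∈ Icc (-1 : ℝ) 1, u x = t := fun t => by
    have hm : (2 * (t : ℝ) - 1) ∈ Icc (-1 : ℝ) 1 := by constructor <;> linarith [t.2.1, t.2.2]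
    refine ⟨2 * t - 1, hm, Subtype.ext ?_⟩
    rw [uval _ hm]
    ring
  have mem_cb : ∀ {n : ℕ} {x : Fin n → ℝ}, x ∈ Metric.closedBall 0 1 ↔ ∀ i, x i ∈ Icc (-1 : ℝ) 1 :=
    fun {n x} => by
      rw [mem_closedBall_zero_iff, pi_norm_le_iff_of_nonneg zero_le_one]
      simp only [Real.norm_eq_abs, abs_le, mem_Icc]
  have mem_b : ∀ {n : ℕ} {x : Fin n → ℝ}, x ∈ Metric.ball 0 1 ↔ ∀ i, x i ∈ Ioo (-1 : ℝ) 1 :=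
    fun {n x} => by
      rw [mem_ball_zero_iff, pi_norm_lt_iff zero_lt_one]
      simp only [Real.norm_eq_abs, abs_lt, mem_Ioo]
  let d : ι₀ ⊕ ι₁ ⊕ ι₂ → ℕ := fun i =>
    match i with
    | .inl _ => 0
    | .inr (.inl _) => 1
    | .inr (.inr _) => 2
  let Φ : ∀ i, (Fin (d i) → ℝ) → X := fun i =>
    match i with
    | .inl i => fun _ => p i
    | .inr (.inl i) => fun x => φ i (u (x 0))
    | .inr (.inr i) => fun x => ψ i (u (x 0), u (x 1))
  have ball1 : ∀ {x : Fin 1 → ℝ}, x ∈ Metric.ball 0 1 → u (x 0) ∈ Ioo (0 : I) 1 := fun {x} hx =>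
    (uIoo _ (Ioo_subset_Icc_self (mem_b.1 hx 0))).2 (mem_b.1 hx 0)
  have ball2 : ∀ {x : Fin 2 → ℝ}, x ∈ Metric.ball 0 1 → ∀ k, u (x k) ∈ Ioo (0 : I) 1 :=
    fun {x} hx k => (uIoo _ (Ioo_subset_Icc_self (mem_b.1 hx k))).2 (mem_b.1 hx k)
  have key := hasEulerChar_of_family d Φ ?_ ?_ ?_ ?_ ?_
  · convert key using 1
    simp only [Fintype.sum_sum_type, d]
    simp
    ring
  · rintro (i | i | i)
    · exact continuousOn_const
    · exact ((hφ i).comp (hu.comp (continuous_apply (0 : Fin 1)))).continuousOn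
    · exact ((hψ i).comp ((hu.comp (continuous_apply (0 : Fin 2))).prodMk
        (hu.comp (continuous_apply (1 : Fin 2))))).continuousOn
  · rintro (i | i | i)
    · intro x _ y _ _
      exact funext fun k => k.elim0
    · intro x hx y hy h
      have := uinj _ (mem_cb.1 hx 0) _ (mem_cb.1 hy 0) (iφ i h)
      exact funext fun k => by rwa [Subsingleton.elim k (0 : Fin 1)]
    · intro x hx y hy h
      have h' := iψ i h
      have h0 := uinj _ (mem_cb.1 hx 0) _ (mem_cb.1 hy 0) (congrArg Prod.fst h')
      have h1 := uinj _ (mem_cb.1 hx 1) _ (mem_cb.1 hy 1) (congrArg Prod.snd h')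
      exact funext fun k => match k with
        | 0 => h0
        | 1 => h1
  · rintro (i | i | i) (j | j | j) x hx y hy h
    · exact congrArg _ (d00 h)
    · exact absurd h (d01 i j _ (ball1 hy))
    · exact absurd h (d02 i j (_, _) (ball2 hy 0) (ball2 hy 1))
    · exact absurd h.symm (d01 j i _ (ball1 hx))
    · rw [d11 i j _ (ball1 hx) _ (ball1 hy) h]
    · exact absurd h (d12 i j _ (ball1 hx) (_, _) (ball2 hy 0) (ball2 hy 1))
    · exact absurd h.symm (d02 j i (_, _) (ball2 hx 0) (ball2 hx 1))
    · exact absurd h.symm (d12 j i _ (ball1 hy) (_, _) (ball2 hx 0) (ball2 hx 1))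
    · rw [d22 i j (_, _) (ball2 hx 0) (ball2 hx 1) (_, _) (ball2 hy 0) (ball2 hy 1) h]
  · rintro (i | i | i) x hx
    · have : x = 0 := funext fun k => k.elim0
      simp [this] at hx
    · have hx1 := mem_cb.1 (Metric.sphere_subset_closedBall hx)
      have : u (x 0) = 0 ∨ u (x 0) = 1 := by
        by_contra! hne
        have hIoo := (uIoo _ (hx1 0)).1 ⟨unitInterval.pos_iff_ne_zero.2 hne.1,
          unitInterval.lt_one_iff_ne_one.2 hne.2⟩
        have hb : x ∈ Metric.ball 0 1 := mem_b.2 fun k => by rwa [Subsingleton.elim k (0 : Fin 1)]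
        exact (Metric.sphere_disjoint_ball.le_bot ⟨hx, hb⟩).elim
      obtain ⟨j, hj⟩ := b1 i _ this
      exact ⟨.inl j, Nat.zero_lt_one, 0, by simp, hj⟩
    · have hx1 := mem_cb.1 (Metric.sphere_subset_closedBall hx)
      obtain ⟨j, t, h⟩ := b2 i (u (x 0), u (x 1)) fun h => by
        have hb : x ∈ Metric.ball 0 1 := mem_b.2 fun k => match k with
          | 0 => (uIoo _ (hx1 0)).1 h.1
          | 1 => (uIoo _ (hx1 1)).1 h.2
        exact (Metric.sphere_disjoint_ball.le_bot ⟨hx, hb⟩).elim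
      obtain ⟨y, hy, rfl⟩ := usurj t
      exact ⟨.inr (.inl j), Nat.one_lt_two, fun _ => y, mem_cb.2 fun _ => hy, h⟩
  · intro x
    obtain ⟨i, q, rfl⟩ := hcov x
    obtain ⟨a, ha, ha'⟩ := usurj q.1
    obtain ⟨b, hb, hb'⟩ := usurj q.2
    refine ⟨.inr (.inr i), ![a, b], mem_cb.2 fun k => ?_, ?_⟩
    · match k with
      | 0 => exact ha
      | 1 => exact hb
    · change ψ i (u a, u b) = _
      rw [ha', hb']

end Cells

namespace HandleStructure

variable {M : Type*} [TopologicalSpace M] (H : HandleStructure M)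

/-! ### The discs and strips of `𝓕` -/

theorem h1_eq_iff {j j' : H.I1} {p p' : I × D2} : H.h1 j p = H.h1 j' p' ↔ j = j' ∧ p = p' := by
  constructor
  · intro h
    have := @H.inj1 (j, p) (j', p') h
    exact ⟨congrArg Prod.fst this, congrArg Prod.snd this⟩
  · rintro ⟨rfl, rfl⟩; rfl

theorem h2_eq_iff {k k' : H.I2} {p p' : D2 × I} : H.h2 k p = H.h2 k' p' ↔ k = k' ∧ p = p' := by
  constructor
  · intro h
    have := @H.inj2 (k, p) (k', p') h
    exact ⟨congrArg Prod.fst this, congrArg Prod.snd this⟩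
  · rintro ⟨rfl, rfl⟩; rfl

theorem h0_mem_bdH0_iff {i : H.I0} {y : D3} :
    H.h0 i y ∈ H.bdH0 ↔ ‖(y : EuclideanSpace ℝ (Fin 3))‖ = 1 := by
  constructor
  · intro h
    obtain ⟨i', y', hy', e⟩ := mem_iUnion.1 h
    have := @H.inj0 (i', y') (i, y) e
    obtain rfl : y' = y := congrArg Prod.snd this
    exact hy'
  · exact fun h => mem_iUnion.2 ⟨i, y, h, rfl⟩

theorem bdH0_subset_H0 : H.bdH0 ⊆ H.H0 := fun _ hx => by
  obtain ⟨i, y, -, e⟩ := mem_iUnion.1 hx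
  exact ⟨i, y, e⟩

theorem h1_mem_H0_iff {j : H.I1} {p : I × D2} : H.h1 j p ∈ H.H0 ↔ p.1 = 0 ∨ p.1 = 1 :=
  H.attach1 j p

theorem h1_mem_bdF0_iff {j : H.I1} {p : I × D2} :
    H.h1 j p ∈ H.bdF0 ↔ (p.1 = 0 ∨ p.1 = 1) ∧ ‖(p.2 : ℂ)‖ = 1 := by
  constructor
  · rintro ⟨j', p', h, hn, e⟩
    obtain ⟨-, rfl⟩ := H.h1_eq_iff.1 e
    exact ⟨h, hn⟩
  · exact fun h => ⟨j, p, h.1, h.2, rfl⟩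

theorem F0_subset_bdH0 : H.F0 ⊆ H.bdH0 := by
  rintro _ ⟨h, j, p, rfl⟩
  obtain ⟨i, y, hy, e⟩ := H.attach1_sphere j p (H.h1_mem_H0_iff.1 h)
  exact mem_iUnion.2 ⟨i, y, hy, e⟩

theorem valence_cast_pos (k : H.I2) : (0 : ℝ) < H.valence k := by
  exact_mod_cast H.valence_pos k

/-- Every point of the attaching circle of a 2-handle is in the interior of an even arc or in an
odd arc. -/
theorem rim_even_or_odd (k : H.I2) (φ : ℝ) :
    (∃ r : Fin (H.valence k), ∃ θ ∈ Ioo (2 * (r : ℝ)) (2 * (r : ℝ) + 1),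
      rim φ = rim (θ / (2 * H.valence k))) ∨
    ∃ r : Fin (H.valence k), ∃ s : I, rim φ = rim ((2 * (r : ℝ) + 1 + s) / (2 * H.valence k)) := by
  have hv := H.valence_cast_pos k
  set v : ℝ := (H.valence k : ℝ) with hvdef
  -- The representative is taken in `(0, 1]`, and the ceiling below puts `2ψv` in `(2r, 2r + 2]`:
  -- the start of an even arc then counts as the end `s = 1` of the preceding odd arc.
  obtain ⟨ψ, hψ0, hψ1, e⟩ : ∃ ψ : ℝ, 0 < ψ ∧ ψ ≤ 1 ∧ rim φ = rim ψ := by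
    refine ⟨φ - (⌈φ⌉ - 1), by linarith [Int.ceil_lt_add_one φ], by linarith [Int.le_ceil φ],
      rim_eq_rim_iff.2 ⟨⌈φ⌉ - 1, ?_⟩⟩
    push_cast
    ring
  have hn0 : 0 < ⌈ψ * v⌉₊ := Nat.ceil_pos.2 (by positivity)
  have hn1 : ⌈ψ * v⌉₊ ≤ H.valence k := Nat.ceil_le.2 (by
    rw [← hvdef]; nlinarith)
  have hle := Nat.le_ceil (ψ * v)
  have hlt := Nat.ceil_lt_add_one (a := ψ * v) (by positivity)
  let r : Fin (H.valence k) := ⟨⌈ψ * v⌉₊ - 1, by omega⟩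
  have hr : (r : ℝ) = (⌈ψ * v⌉₊ : ℝ) - 1 := by
    simp only [r]
    rw [Nat.cast_sub hn0]
    simp
  by_cases h : 2 * (ψ * v) < 2 * (r : ℝ) + 1
  · left
    refine ⟨r, 2 * (ψ * v), ⟨by rw [hr]; linarith, h⟩, ?_⟩
    rw [e]
    congr 1
    field_simp
  · right
    refine ⟨r, ⟨2 * (ψ * v) - (2 * r + 1), by linarith, by rw [hr]; linarith⟩, ?_⟩
    rw [e]
    congr 1
    field_simp
    ring

theorem odd_arc_mem (k : H.I2) (r : Fin (H.valence k)) (s t : I) : ∃ (j : H.I1) (p : I × D2),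
    ‖(p.2 : ℂ)‖ = 1 ∧ H.h2 k (rim ((2 * (r : ℝ) + 1 + s) / (2 * H.valence k)), t) = H.h1 j p := by
  obtain ⟨j, b, hb, h | h⟩ := H.odd_arc k r
  · exact ⟨j, (s, b t), hb t, h s t⟩
  · exact ⟨j, (unitInterval.symm s, b t), hb t, h s t⟩

theorem even_arc_mem_bdH0 {k : H.I2} {r : Fin (H.valence k)} {θ : ℝ} {t : I}
    (h : θ ∈ Icc (2 * (r : ℝ)) (2 * (r : ℝ) + 1)) :
    H.h2 k (rim (θ / (2 * H.valence k)), t) ∈ H.bdH0 := by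
  obtain ⟨i, y, hy, e⟩ := H.even_arc k r θ t h
  exact mem_iUnion.2 ⟨i, y, hy, e⟩

/-- A 2-handle meets the 1-handles in points of their vertical boundary. -/
theorem norm_eq_one_of_h2_eq_h1 {k : H.I2} {y : D2 × I} {j : H.I1} {p : I × D2}
    (h : H.h2 k y = H.h1 j p) : ‖(p.2 : ℂ)‖ = 1 := by
  have hy : ‖(y.1 : ℂ)‖ = 1 := (H.attach2 k y).1 (Or.inr ⟨j, p, h.symm⟩)
  obtain ⟨φ, hφ⟩ := exists_rim_eq hy
  have hyφ : y = (rim φ, y.2) := by rw [hφ]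
  rw [hyφ] at h
  -- Open even arcs miss the 1-handles, and odd arcs are glued along `D¹ × ∂D²`.
  rcases H.rim_even_or_odd k φ with ⟨r, θ, hθ, e⟩ | ⟨r, s, e⟩
  · rw [e] at h
    exact absurd ⟨j, p, h.symm⟩ (H.even_arc_open k r θ y.2 hθ)
  · obtain ⟨j', p', hp', e'⟩ := H.odd_arc_mem k r s y.2
    rw [e, e'] at h
    obtain ⟨-, rfl⟩ := H.h1_eq_iff.1 h
    exact hp'

theorem mem_bdF0_of_mem_F0_of_mem_H2 {x : M} (h0 : x ∈ H.F0) (h2 : x ∈ H.H2) : x ∈ H.bdF0 := by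
  obtain ⟨h0, j, p, rfl⟩ := h0
  obtain ⟨k, y, e⟩ := h2
  exact H.h1_mem_bdF0_iff.2 ⟨H.h1_mem_H0_iff.1 h0, H.norm_eq_one_of_h2_eq_h1 e⟩

theorem core_subset_strip (q : H.Strip) (t : I) : H.core q t ⊆ H.strip q :=
  subset_iUnion _ t

theorem strip_subset_H2 (q : H.Strip) : H.strip q ⊆ H.H2 := fun x hx => by
  obtain ⟨t, θ, -, e⟩ := mem_iUnion.1 hx
  exact ⟨_, _, e⟩

theorem strip_subset_bdH0 (q : H.Strip) : H.strip q ⊆ H.bdH0 := fun x hx => by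
  obtain ⟨t, θ, h, rfl⟩ := mem_iUnion.1 hx
  exact H.even_arc_mem_bdH0 h

theorem strip_subset_F1 (q : H.Strip) : H.strip q ⊆ H.F1 := fun _ hx =>
  ⟨H.bdH0_subset_H0 (H.strip_subset_bdH0 q hx), H.strip_subset_H2 q hx⟩

/-- Since `r + 1 ≤ valence k`, the last even arc stops before the angle `1`, so all even arcs lie in
one period, where `rim` is injective. -/
theorem even_arc_angle_mem {k : H.I2} {r : Fin (H.valence k)} {θ : ℝ}
    (h : θ ∈ Icc (2 * (r : ℝ)) (2 * (r : ℝ) + 1)) :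
    θ / (2 * H.valence k) ∈ Ico (0 : ℝ) (0 + 1) := by
  have hv := H.valence_cast_pos k
  have hr : (r : ℝ) + 1 ≤ H.valence k := by exact_mod_cast r.2
  have hr0 : (0 : ℝ) ≤ r := by positivity
  constructor
  · exact div_nonneg (by linarith [h.1]) (by linarith)
  · rw [div_lt_iff₀ (by linarith)]
    linarith [h.2]

theorem even_arc_angle_injective {k : H.I2} {r r' : Fin (H.valence k)} {θ θ' : ℝ}
    (h : θ ∈ Icc (2 * (r : ℝ)) (2 * (r : ℝ) + 1))
    (h' : θ' ∈ Icc (2 * (r' : ℝ)) (2 * (r' : ℝ) + 1))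
    (e : rim (θ / (2 * H.valence k)) = rim (θ' / (2 * H.valence k))) : θ = θ' := by
  have hv := H.valence_cast_pos k
  have := rim_injOn (H.even_arc_angle_mem h) (H.even_arc_angle_mem h') e
  field_simp at this
  exact this

theorem strip_eq_of_mem {q q' : H.Strip} {x : M} (h : x ∈ H.strip q) (h' : x ∈ H.strip q') :
    q = q' := by
  obtain ⟨k, r⟩ := q
  obtain ⟨k', r'⟩ := q'
  obtain ⟨t, θ, hθ, rfl⟩ := mem_iUnion.1 h
  obtain ⟨t', θ', hθ', e⟩ := mem_iUnion.1 h'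
  dsimp only at hθ hθ' e
  obtain ⟨rfl, e⟩ := H.h2_eq_iff.1 e
  have := H.even_arc_angle_injective hθ' hθ (congrArg Prod.fst e)
  subst this
  -- The intervals `[2r, 2r + 1]` for distinct `r` are separated by gaps of length at least one.
  have h1 : (2 * (r : ℝ)) < 2 * r' + 2 := by linarith [hθ.1, hθ'.2]
  have h2 : (2 * (r' : ℝ)) < 2 * r + 2 := by linarith [hθ.2, hθ'.1]
  have h1' : (r : ℕ) < r' + 1 := by exact_mod_cast (by linarith : (r : ℝ) < r' + 1)
  have h2' : (r' : ℕ) < r + 1 := by exact_mod_cast (by linarith : (r' : ℝ) < r + 1)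
  have : r = r' := Fin.ext (by omega)
  rw [this]

/-- A fibre of a strip meets `𝓕⁰` in at most two points. -/
theorem core_inter_F0 {q : H.Strip} {t : I} {x : M} (h : x ∈ H.core q t) (h0 : x ∈ H.F0) :
    x = H.h2 q.1 (rim (2 * (q.2 : ℝ) / (2 * H.valence q.1)), t) ∨
      x = H.h2 q.1 (rim ((2 * (q.2 : ℝ) + 1) / (2 * H.valence q.1)), t) := by
  obtain ⟨θ, hθ, rfl⟩ := h
  rcases hθ.1.eq_or_lt with h1 | h1
  · left; rw [h1]
  rcases hθ.2.eq_or_lt with h2 | h2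
  · right; rw [h2]
  · exact absurd h0.2 (fun ⟨j, y, e⟩ => H.even_arc_open q.1 q.2 θ t ⟨h1, h2⟩ ⟨j, y, e⟩)

end HandleStructure

theorem eq_zero_or_mem_Ioo {u : I} (hu : u < 1) : u = 0 ∨ u ∈ Ioo (0 : I) 1 :=
  (unitInterval.nonneg' : (0 : I) ≤ u).eq_or_lt.imp Eq.symm fun h => ⟨h, hu⟩

namespace AdmissibleSurface

variable {M : Type*} [TopologicalSpace M] [ChartedSpace (EuclideanHalfSpace 3) M]
  {H : HandleStructure M} {F : Type*} [TopologicalSpace F]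
  [ChartedSpace (EuclideanHalfSpace 2) F] (S : AdmissibleSurface H F)

/-! ### The arcs that form the boundaries of the 0-handles -/

theorem e0_eq_iff {c c' : S.K0} {y y' : D2} : S.e0 c y = S.e0 c' y' ↔ c = c' ∧ y = y' := by
  constructor
  · intro h
    have := @S.einj0 (c, y) (c', y') h
    exact ⟨congrArg Prod.fst this, congrArg Prod.snd this⟩
  · rintro ⟨rfl, rfl⟩; rfl

theorem e1_eq_iff {c c' : S.K1} {y y' : I × I} : S.e1 c y = S.e1 c' y' ↔ c = c' ∧ y = y' := by
  constructor
  · intro h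
    have := @S.einj1 (c, y) (c', y') h
    exact ⟨congrArg Prod.fst this, congrArg Prod.snd this⟩
  · rintro ⟨rfl, rfl⟩; rfl

theorem e2_eq_iff {c c' : S.K2} {y y' : D2} : S.e2 c y = S.e2 c' y' ↔ c = c' ∧ y = y' := by
  constructor
  · intro h
    have := @S.einj2 (c, y) (c', y') h
    exact ⟨congrArg Prod.fst this, congrArg Prod.snd this⟩
  · rintro ⟨rfl, rfl⟩; rfl

/-- The number of arcs into which the boundary of a 0-handle is cut. -/
def numArcs (c : S.K0) : ℕ := (S.zero_boundary c).choose

/-- The kinds of the arcs into which the boundary of a 0-handle is cut. -/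
def kind (c : S.K0) : ZMod (S.numArcs c) → Piece := (S.zero_boundary c).choose_spec.choose

theorem isSubdivided (c : S.K0) :
    H.IsSubdivided (fun θ => S.f (S.e0 c (rim θ))) (S.numArcs c) (S.kind c) :=
  (S.zero_boundary c).choose_spec.choose_spec.1

theorem free_subset_bdry (c : S.K0) (j : ℕ) (h : S.kind c j = .free) :
    ∀ θ ∈ Icc ((j : ℝ) / S.numArcs c) ((j + 1) / S.numArcs c),
      S.e0 c (rim θ) ∈ bdry2 F ∧ S.f (S.e0 c (rim θ)) ∉ bdry3 M :=
  (S.zero_boundary c).choose_spec.choose_spec.2 j h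

instance (c : S.K0) : NeZero (S.numArcs c) := ⟨(S.isSubdivided c).1.ne'⟩

/-- The index set of the arcs in the boundaries of the 0-handles. -/
abbrev Arc : Type := Σ c : S.K0, ZMod (S.numArcs c)

variable {S}

/-- The kind of an arc. -/
def Arc.kind (a : S.Arc) : Piece := S.kind a.1 a.2

/-- The arc following a given one. -/
def Arc.next (a : S.Arc) : S.Arc := ⟨a.1, a.2 + 1⟩

/-- The arc preceding a given one. -/
def Arc.prev (a : S.Arc) : S.Arc := ⟨a.1, a.2 - 1⟩

/-- The parametrisation of an arc. -/
def Arc.pt (a : S.Arc) (u : I) : F := S.e0 a.1 (rim ((a.2.val + u) / S.numArcs a.1))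

namespace Arc

theorem next_prev (a : S.Arc) : a.prev.next = a :=
  Sigma.ext rfl (heq_of_eq (sub_add_cancel a.2 1))

theorem prev_next (a : S.Arc) : a.next.prev = a :=
  Sigma.ext rfl (heq_of_eq (add_sub_cancel_right a.2 1))

theorem numArcs_cast_pos (a : S.Arc) : (0 : ℝ) < S.numArcs a.1 := by
  exact_mod_cast (S.isSubdivided a.1).1

theorem continuous_pt (a : S.Arc) : Continuous a.pt :=
  (S.econt0 a.1).comp (continuous_rim.comp (by fun_prop))

/-- Arc indices are taken modulo the number of arcs, so the last arc is followed by the first one;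
the angles then differ by a full turn. -/
theorem pt_one (a : S.Arc) : a.pt 1 = a.next.pt 0 := by
  obtain ⟨c, j⟩ := a
  have hn := numArcs_cast_pos (S := S) ⟨c, j⟩
  dsimp only at hn
  simp only [pt, next, Icc.coe_one, Icc.coe_zero, add_zero]
  congr 1
  have h1 : j + 1 = ((j.val + 1 : ℕ) : ZMod (S.numArcs c)) := by simp
  rw [h1, ZMod.val_natCast]
  -- This quotient counts the turns: `1` when the index wraps around, `0` otherwise.
  refine rim_eq_rim_iff.2 ⟨((j.val + 1) / S.numArcs c : ℕ), ?_⟩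
  have h2 : ((j.val + 1 : ℕ) : ℝ) = ((j.val + 1) % S.numArcs c : ℕ)
      + S.numArcs c * ((j.val + 1) / S.numArcs c : ℕ) := by
    exact_mod_cast (Nat.mod_add_div _ _).symm
  rw [Nat.cast_add, Nat.cast_one] at h2
  rw [h2, Int.cast_natCast]
  field_simp

theorem angle_mem (a : S.Arc) {u : I} (hu : u < 1) :
    ((a.2.val : ℝ) + u) / S.numArcs a.1 ∈ Ico (0 : ℝ) (0 + 1) := by
  have hn := a.numArcs_cast_pos
  have h1 : ((a.2.val : ℝ)) + 1 ≤ S.numArcs a.1 := by exact_mod_cast ZMod.val_lt a.2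
  have h2 : (u : ℝ) < 1 := hu
  have h3 := u.2.1
  constructor
  · positivity
  · rw [div_lt_iff₀ hn]; linarith

/-- With the end `u = 1` removed, the arcs partition the boundary circles of the 0-handles. -/
theorem pt_eq_pt {a b : S.Arc} {u v : I} (hu : u < 1) (hv : v < 1) (h : a.pt u = b.pt v) :
    a = b ∧ u = v := by
  obtain ⟨c, j⟩ := a
  obtain ⟨c', k⟩ := b
  obtain ⟨h1, h2⟩ := S.e0_eq_iff.1 h
  dsimp only at h1
  subst h1
  have hn := numArcs_cast_pos (S := S) ⟨c, j⟩
  have h3 := rim_injOn (angle_mem (S := S) ⟨c, j⟩ hu) (angle_mem (S := S) ⟨c, k⟩ hv) h2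
  dsimp only at h3 hn
  have h4 : (j.val : ℝ) + u = k.val + v := by field_simp at h3; exact h3
  have hu' : (u : ℝ) < 1 := hu
  have hv' : (v : ℝ) < 1 := hv
  have hu0 := u.2.1
  have hv0 := v.2.1
  have h5 : j.val < k.val + 1 := by exact_mod_cast (by linarith : (j.val : ℝ) < k.val + 1)
  have h6 : k.val < j.val + 1 := by exact_mod_cast (by linarith : (k.val : ℝ) < j.val + 1)
  have h7 : j = k := ZMod.val_injective _ (by omega)
  subst h7
  exact ⟨rfl, Subtype.ext (by linarith)⟩

theorem exists_pt_eq {c : S.K0} {y : D2} (hy : ‖(y : ℂ)‖ = 1) :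
    ∃ a : S.Arc, a.1 = c ∧ ∃ u < 1, a.pt u = S.e0 c y := by
  obtain ⟨φ, rfl⟩ := exists_rim_eq hy
  have hn : (0 : ℝ) < S.numArcs c := by exact_mod_cast (S.isSubdivided c).1
  obtain ⟨ψ, h0, h1, e⟩ : ∃ ψ : ℝ, 0 ≤ ψ ∧ ψ < 1 ∧ rim φ = rim ψ :=
    ⟨Int.fract φ, Int.fract_nonneg _, Int.fract_lt_one _,
      rim_eq_rim_iff.2 ⟨⌊φ⌋, (Int.fract_add_floor φ).symm⟩⟩
  have hle := Nat.floor_le (a := ψ * S.numArcs c) (by positivity)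
  have hlt := Nat.lt_floor_add_one (ψ * S.numArcs c)
  have hn' : ⌊ψ * S.numArcs c⌋₊ < S.numArcs c := by
    rw [Nat.floor_lt (by positivity)]
    nlinarith
  refine ⟨⟨c, (⌊ψ * S.numArcs c⌋₊ : ℕ)⟩, rfl,
    ⟨ψ * S.numArcs c - ⌊ψ * S.numArcs c⌋₊, by linarith, by linarith⟩, ?_, ?_⟩
  · exact Subtype.coe_lt_coe.1 (by simp only [Icc.coe_one]; linarith)
  · simp only [pt]
    rw [e, ZMod.val_natCast, Nat.mod_eq_of_lt hn']
    congr 2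
    field_simp
    ring

theorem angle_mem_Icc (a : S.Arc) (u : I) : ((a.2.val : ℝ) + u) / S.numArcs a.1 ∈
    Icc ((a.2.val : ℝ) / S.numArcs a.1) ((a.2.val + 1) / S.numArcs a.1) := by
  have hn := a.numArcs_cast_pos
  constructor <;> gcongr
  · linarith [u.2.1]
  · exact u.2.2

theorem angle_mem_Ioo (a : S.Arc) {u : I} (hu : u ∈ Ioo (0 : I) 1) :
    ((a.2.val : ℝ) + u) / S.numArcs a.1 ∈
    Ioo ((a.2.val : ℝ) / S.numArcs a.1) ((a.2.val + 1) / S.numArcs a.1) := by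
  have hn := a.numArcs_cast_pos
  have h0 : (0 : ℝ) < u := hu.1
  have h1 : (u : ℝ) < 1 := hu.2
  constructor <;> gcongr
  linarith

theorem exists_angle_eq (a : S.Arc) {θ : ℝ}
    (hθ : θ ∈ Icc ((a.2.val : ℝ) / S.numArcs a.1) ((a.2.val + 1) / S.numArcs a.1)) :
    ∃ u : I, θ = ((a.2.val : ℝ) + u) / S.numArcs a.1 := by
  have hn := a.numArcs_cast_pos
  have h1 := (div_le_iff₀ hn).1 hθ.1
  have h2 := (le_div_iff₀ hn).1 hθ.2
  refine ⟨⟨θ * S.numArcs a.1 - a.2.val, by linarith, by linarith⟩, ?_⟩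
  field_simp
  ring

theorem isPiece (a : S.Arc) : H.IsPiece (fun θ => S.f (S.e0 a.1 (rim θ)))
    ((a.2.val : ℝ) / S.numArcs a.1) ((a.2.val + 1) / S.numArcs a.1) a.kind := by
  have := ((S.isSubdivided a.1).2 a.2.val).1
  rwa [ZMod.natCast_zmod_val] at this

theorem kind_next_ne (a : S.Arc) : a.next.kind ≠ a.kind := by
  have := ((S.isSubdivided a.1).2 a.2.val).2
  rw [Nat.cast_add, Nat.cast_one, ZMod.natCast_zmod_val] at this
  exact this.symm

theorem next_ne (a : S.Arc) : a.next ≠ a := fun h => a.kind_next_ne (by rw [h])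

theorem zero_mem_F0 {a : S.Arc} (h : a.kind = .zero) (u : I) : S.f (a.pt u) ∈ H.F0 := by
  have := a.isPiece
  rw [h] at this
  exact this.1 _ (a.angle_mem_Icc u)

theorem zero_notMem_bdF0 {a : S.Arc} (h : a.kind = .zero) {u : I} (hu : u ∈ Ioo (0 : I) 1) :
    S.f (a.pt u) ∉ H.bdF0 := by
  have := a.isPiece
  rw [h] at this
  exact this.2.1 _ (a.angle_mem_Ioo hu)

theorem exists_range_eq_core {a : S.Arc} (h : a.kind = .one) :
    ∃ q t, range (fun u => S.f (a.pt u)) = H.core q t := by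
  have := a.isPiece
  rw [h] at this
  obtain ⟨-, q, t, -, -, e⟩ := this
  refine ⟨q, t, ?_⟩
  rw [← e]
  ext x
  constructor
  · rintro ⟨u, rfl⟩
    exact ⟨_, a.angle_mem_Icc u, rfl⟩
  · rintro ⟨θ, hθ, rfl⟩
    obtain ⟨u, rfl⟩ := a.exists_angle_eq hθ
    exact ⟨u, rfl⟩

theorem one_injective {a : S.Arc} (h : a.kind = .one) :
    Function.Injective fun u => S.f (a.pt u) := by
  have := a.isPiece
  rw [h] at this
  intro u v huv
  have h1 := this.1 (a.angle_mem_Icc u) (a.angle_mem_Icc v) huv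
  have hn := a.numArcs_cast_pos
  field_simp at h1
  exact Subtype.ext (by linarith)

theorem pt_zero_eq (a : S.Arc) : a.pt 0 = S.e0 a.1 (rim ((a.2.val : ℝ) / S.numArcs a.1)) := by
  simp [pt]

theorem pt_one_eq (a : S.Arc) : a.pt 1 = S.e0 a.1 (rim ((a.2.val + 1 : ℝ) / S.numArcs a.1)) := by
  simp [pt]

theorem outer_mem {a : S.Arc} (h : a.kind = .outer) (u : I) :
    S.f (a.pt u) ∈ H.bdH0 ∩ bdry3 M := by
  have := a.isPiece
  rw [h] at this
  exact this.1 _ (a.angle_mem_Icc u)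

theorem outer_notMem_surf {a : S.Arc} (h : a.kind = .outer) {u : I} (hu : u ∈ Ioo (0 : I) 1) :
    S.f (a.pt u) ∉ H.surf := by
  have := a.isPiece
  rw [h] at this
  exact this.2.1 _ (a.angle_mem_Ioo hu)

theorem outer_ends {a : S.Arc} (h : a.kind = .outer) {u : I} (hu : u = 0 ∨ u = 1) :
    S.f (a.pt u) ∈ H.bdF0 \ H.F1 := by
  have := a.isPiece
  rw [h] at this
  rcases hu with rfl | rfl
  · rw [pt_zero_eq]; exact this.2.2.2.1
  · rw [pt_one_eq]; exact this.2.2.2.2.1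

theorem free_notMem_bdH0 {a : S.Arc} (h : a.kind = .free) {u : I} (hu : u ∈ Ioo (0 : I) 1) :
    S.f (a.pt u) ∉ H.bdH0 := by
  have := a.isPiece
  rw [h] at this
  exact (this.1 _ (a.angle_mem_Ioo hu)).2

theorem free_ends {a : S.Arc} (h : a.kind = .free) {u : I} (hu : u = 0 ∨ u = 1) :
    S.f (a.pt u) ∈ H.F0 \ H.bdF0 := by
  have := a.isPiece
  rw [h] at this
  rcases hu with rfl | rfl
  · rw [pt_zero_eq]; exact this.2.1
  · rw [pt_one_eq]; exact this.2.2

theorem free_mem_bdry {a : S.Arc} (h : a.kind = .free) (u : I) :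
    a.pt u ∈ bdry2 F ∧ S.f (a.pt u) ∉ bdry3 M := by
  refine S.free_subset_bdry a.1 a.2.val ?_ _ (a.angle_mem_Icc u)
  rw [ZMod.natCast_zmod_val]
  exact h

theorem one_mem_F1 {a : S.Arc} (h : a.kind = .one) (u : I) : S.f (a.pt u) ∈ H.F1 := by
  obtain ⟨q, t, e⟩ := exists_range_eq_core h
  refine H.strip_subset_F1 q (H.core_subset_strip q t ?_)
  rw [← e]
  exact mem_range_self u

/-- The end point of an arc determines its kind, among the kinds other than `Piece.zero`. -/
theorem kind_eq_of_ends {a b : S.Arc} {u v : I} (hu : u = 0 ∨ u = 1) (hv : v = 0 ∨ v = 1)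
    (e : a.pt u = b.pt v) (ha : a.kind ≠ .zero) (hb : b.kind ≠ .zero) : a.kind = b.kind := by
  -- Ends of `one` arcs lie in `𝓕¹`, ends of `outer` arcs in `∂𝓕⁰ - 𝓕¹`, ends of `free` arcs off
  -- `∂𝓕⁰`. A point of `𝓕⁰` in a 2-handle is on `∂𝓕⁰`, so these places are mutually exclusive.
  have key : ∀ {a b : S.Arc} {u v : I}, (u = 0 ∨ u = 1) → (v = 0 ∨ v = 1) → a.pt u = b.pt v →
      (a.kind = .one → b.kind ≠ .outer) ∧ (a.kind = .one → b.kind ≠ .free) ∧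
      (a.kind = .outer → b.kind ≠ .free) := by
    intro a b u v hu hv e
    refine ⟨fun ha hb => ?_, fun ha hb => ?_, fun ha hb => ?_⟩
    · exact (outer_ends hb hv).2 (e ▸ one_mem_F1 ha u)
    · exact (free_ends hb hv).2 (H.mem_bdF0_of_mem_F0_of_mem_H2 (free_ends hb hv).1
        (e ▸ (one_mem_F1 ha u).2))
    · exact (free_ends hb hv).2 (e ▸ (outer_ends ha hu).1)
  have h1 := key hu hv e
  have h2 := key hv hu e.symm
  generalize a.kind = p at *
  generalize b.kind = q at *
  cases p <;> cases q <;> simp_all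

/-- This is the alternation. Two successive arcs, neither of kind `zero`, would share an end point
and hence a kind, but successive kinds differ. -/
theorem kind_next_eq_zero_iff (a : S.Arc) : a.next.kind = .zero ↔ a.kind ≠ .zero := by
  constructor
  · intro h h'
    exact a.kind_next_ne (h.trans h'.symm)
  · intro h
    by_contra h'
    exact a.kind_next_ne (kind_eq_of_ends (Or.inr rfl) (Or.inl rfl) a.pt_one h h').symm

theorem kind_prev_eq_zero_iff (a : S.Arc) : a.prev.kind = .zero ↔ a.kind ≠ .zero := by
  have := a.prev.kind_next_eq_zero_iff
  rw [next_prev] at this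
  tauto

theorem prev_pt_one (a : S.Arc) : a.prev.pt 1 = a.pt 0 := by
  rw [pt_one, next_prev]

/-- Even the closed arc is embedded: its end is the start of the next arc, which is a different arc
because its kind differs. -/
theorem pt_injective (a : S.Arc) : Function.Injective a.pt := by
  have key : ∀ v : I, v < 1 → a.pt 1 ≠ a.pt v := fun v hv e => by
    rw [pt_one] at e
    exact a.next_ne (pt_eq_pt zero_lt_one hv e).1
  intro u v h
  rcases unitInterval.le_one'.eq_or_lt (a := u) with rfl | hu
  · by_contra hne
    exact key v (lt_of_le_of_ne unitInterval.le_one' (Ne.symm hne)) h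
  rcases unitInterval.le_one'.eq_or_lt (a := v) with rfl | hv
  · exact absurd h.symm (key u hu)
  exact (pt_eq_pt hu hv h).2

/-- Two arcs of the same type, `Piece.zero` or not, are equal or disjoint. -/
theorem eq_of_mem_range {a b : S.Arc} {x : F} (ha : x ∈ range a.pt) (hb : x ∈ range b.pt)
    (h : a.kind = .zero ↔ b.kind = .zero) : a = b := by
  obtain ⟨u, rfl⟩ := ha
  obtain ⟨v, e⟩ := hb
  rcases unitInterval.le_one'.eq_or_lt (a := u) with rfl | hu <;>
  rcases unitInterval.le_one'.eq_or_lt (a := v) with rfl | hv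
  · rw [pt_one, pt_one] at e
    have := (pt_eq_pt zero_lt_one zero_lt_one e).1
    rw [← a.prev_next, ← this, prev_next]
  · rw [a.pt_one] at e
    have := (pt_eq_pt hv zero_lt_one e).1
    rw [this, kind_next_eq_zero_iff] at h
    tauto
  · rw [b.pt_one] at e
    have := (pt_eq_pt zero_lt_one hu e).1
    rw [← this, kind_next_eq_zero_iff] at h
    tauto
  · exact (pt_eq_pt hv hu e).1.symm

end Arc

end AdmissibleSurface

/-- The end points of the unit interval. -/
def endpt : Bool → I
  | false => 0
  | true => 1

theorem endpt_eq (b : Bool) : endpt b = 0 ∨ endpt b = 1 := by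
  cases b
  · exact Or.inl rfl
  · exact Or.inr rfl

theorem exists_endpt_eq {u : I} (h : u = 0 ∨ u = 1) : ∃ b, endpt b = u := by
  rcases h with rfl | rfl
  · exact ⟨false, rfl⟩
  · exact ⟨true, rfl⟩

theorem endpt_injective : Function.Injective endpt := by
  intro a b h
  cases a <;> cases b <;> first | rfl | simp [endpt] at h

theorem eq_end_or_mem_Ioo (u : I) : (u = 0 ∨ u = 1) ∨ u ∈ Ioo (0 : I) 1 := by
  rcases (unitInterval.le_one' : u ≤ 1).eq_or_lt with h | h
  · exact Or.inl (Or.inr h)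
  · exact (eq_zero_or_mem_Ioo h).imp Or.inl id

namespace AdmissibleSurface

variable {M : Type*} [TopologicalSpace M] [ChartedSpace (EuclideanHalfSpace 3) M]
  {H : HandleStructure M} {F : Type*} [TopologicalSpace F]
  [ChartedSpace (EuclideanHalfSpace 2) F] (S : AdmissibleSurface H F)

/-! ### The 1-handles and 2-handles of the surface -/

/-- The 1-handle of `M` which contains a given 1-handle of `F`. -/
def base1 (c : S.K1) : H.I1 := (S.one_handle c).choose

/-- The arc `g` for which a 1-handle of `F` is `D¹ × g`. -/
def crossArc (c : S.K1) : I → D2 := (S.one_handle c).choose_spec.choose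

theorem f_e1 (c : S.K1) (p : I × I) :
    S.f (S.e1 c p) = H.h1 (S.base1 c) (p.1, S.crossArc c p.2) :=
  (S.one_handle c).choose_spec.choose_spec.2.2.1 p.1 p.2

theorem norm_crossArc_lt (c : S.K1) {t : I} (ht : t ∈ Ioo (0 : I) 1) :
    ‖(S.crossArc c t : ℂ)‖ < 1 :=
  ((S.one_handle c).choose_spec.choose_spec.2.2.2.1 0 t ht.1 ht.2).1

theorem e1_notMem_bdry (c : S.K1) (s : I) {t : I} (ht : t ∈ Ioo (0 : I) 1) :
    S.e1 c (s, t) ∉ bdry2 F :=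
  ((S.one_handle c).choose_spec.choose_spec.2.2.2.1 s t ht.1 ht.2).2

theorem crossArc_end (c : S.K1) {t : I} (ht : t = 0 ∨ t = 1) :
    (‖(S.crossArc c t : ℂ)‖ = 1 ∧
        ((∀ s, S.f (S.e1 c (s, t)) ∈ H.H2) ∨ (∀ s, S.f (S.e1 c (s, t)) ∈ bdry3 M))) ∨
      (‖(S.crossArc c t : ℂ)‖ < 1 ∧
        ∀ s, S.e1 c (s, t) ∈ bdry2 F ∧ S.f (S.e1 c (s, t)) ∉ bdry3 M) :=
  (S.one_handle c).choose_spec.choose_spec.2.2.2.2 t ht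

theorem end_of_norm_crossArc {c : S.K1} {t : I} (h : ‖(S.crossArc c t : ℂ)‖ = 1) :
    t = 0 ∨ t = 1 :=
  (eq_end_or_mem_Ioo t).resolve_right fun ht => (S.norm_crossArc_lt c ht).ne h

theorem e1_mem_H0_iff {c : S.K1} {p : I × I} :
    S.f (S.e1 c p) ∈ H.H0 ↔ p.1 = 0 ∨ p.1 = 1 := by
  rw [f_e1, H.h1_mem_H0_iff]

theorem e1_mem_H1 (c : S.K1) (p : I × I) : S.f (S.e1 c p) ∈ H.H1 :=
  (S.preim1 _).2 ⟨c, p, rfl⟩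

theorem e1_mem_F0_iff {c : S.K1} {p : I × I} :
    S.f (S.e1 c p) ∈ H.F0 ↔ p.1 = 0 ∨ p.1 = 1 :=
  (and_iff_left (S.e1_mem_H1 c p)).trans S.e1_mem_H0_iff

theorem e1_mem_bdF0_iff {c : S.K1} {p : I × I} :
    S.f (S.e1 c p) ∈ H.bdF0 ↔ (p.1 = 0 ∨ p.1 = 1) ∧ ‖(S.crossArc c p.2 : ℂ)‖ = 1 := by
  rw [f_e1, H.h1_mem_bdF0_iff]

/-- The 2-handle of `M` to whose core a given 2-handle of `F` is parallel. -/
def base2 (c : S.K2) : H.I2 := (S.two_handle c).choose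

/-- The height of a 2-handle of `F` in the 2-handle of `M` that contains it. -/
def height (c : S.K2) : I := (S.two_handle c).choose_spec.choose

theorem f_e2 (c : S.K2) (y : D2) : S.f (S.e2 c y) = H.h2 (S.base2 c) (y, S.height c) :=
  (S.two_handle c).choose_spec.choose_spec.2.2 y

theorem e2_mem_H0_or_H1_iff {c : S.K2} {y : D2} :
    S.f (S.e2 c y) ∈ H.H0 ∨ S.f (S.e2 c y) ∈ H.H1 ↔ ‖(y : ℂ)‖ = 1 := by
  rw [f_e2]
  exact H.attach2 _ _

/-! ### Preimages of the pieces of the handle structure -/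

theorem e0_interior_notMem (c : S.K0) {y : D2} (hy : ‖(y : ℂ)‖ < 1) :
    S.e0 c y ∉ bdry2 F ∧ S.f (S.e0 c y) ∉ H.bdH0 := by
  obtain ⟨i, hi⟩ := S.zero_handle c
  obtain ⟨h1, z, hz, e⟩ := hi y hy
  refine ⟨h1, fun h => ?_⟩
  rw [e, H.h0_mem_bdH0_iff] at h
  exact hz.ne h

theorem norm_le_one_of_D2 (y : D2) : ‖(y : ℂ)‖ ≤ 1 := mem_closedBall_zero_iff.1 y.2

variable {S}

theorem exists_pt_eq_of_e0 {c : S.K0} {y : D2}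
    (h : S.e0 c y ∈ bdry2 F ∨ S.f (S.e0 c y) ∈ H.bdH0) :
    ∃ a : S.Arc, a.1 = c ∧ ∃ u < 1, a.pt u = S.e0 c y := by
  refine Arc.exists_pt_eq ((norm_le_one_of_D2 y).eq_of_not_lt fun hy => ?_)
  have := S.e0_interior_notMem c hy
  tauto

theorem exists_pt_eq_of_mem_bdH0 {x : F} (h : S.f x ∈ H.bdH0) :
    ∃ a : S.Arc, ∃ u < 1, a.pt u = x := by
  obtain ⟨c, y, rfl⟩ := (S.preim0 x).1 (H.bdH0_subset_H0 h)
  obtain ⟨a, -, ha⟩ := exists_pt_eq_of_e0 (Or.inr h)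
  exact ⟨a, ha⟩

theorem pt_mem_H0 (a : S.Arc) (u : I) : S.f (a.pt u) ∈ H.H0 :=
  (S.preim0 _).2 ⟨_, _, rfl⟩

/-! ### Intersections of the arcs with `𝓕⁰` and `∂M`, and the corners of the 1-handles -/

namespace Arc

theorem zero_end (a : S.Arc) : ∃ b : S.Arc, b.kind = .zero ∧ b.1 = a.1 ∧ a.pt 0 ∈ range b.pt := by
  by_cases h : a.kind = .zero
  · exact ⟨a, h, rfl, 0, rfl⟩
  · exact ⟨a.prev, a.kind_prev_eq_zero_iff.2 h, rfl, 1, a.prev_pt_one⟩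

theorem nonzero_end (a : S.Arc) :
    ∃ b : S.Arc, b.kind ≠ .zero ∧ b.1 = a.1 ∧ a.pt 0 ∈ range b.pt := by
  by_cases h : a.kind = .zero
  · refine ⟨a.prev, fun h' => ?_, rfl, 1, a.prev_pt_one⟩
    exact a.kind_prev_eq_zero_iff.1 h' h
  · exact ⟨a, h, rfl, 0, rfl⟩

theorem pt_zero_mem_F0 (a : S.Arc) : S.f (a.pt 0) ∈ H.F0 := by
  obtain ⟨b, hb, -, v, e⟩ := a.zero_end
  rw [← e]
  exact zero_mem_F0 hb v

theorem pt_end_mem_F0 (a : S.Arc) {u : I} (hu : u = 0 ∨ u = 1) : S.f (a.pt u) ∈ H.F0 := by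
  rcases hu with rfl | rfl
  · exact a.pt_zero_mem_F0
  · rw [pt_one]
    exact a.next.pt_zero_mem_F0

/-- Together with `zero_mem_F0` this shows that the preimage of `𝓕⁰` consists of the `zero` arcs
alone. -/
theorem notMem_F0 {a : S.Arc} (h : a.kind ≠ .zero) {u : I} (hu : u ∈ Ioo (0 : I) 1) :
    S.f (a.pt u) ∉ H.F0 := by
  intro h0
  cases hk : a.kind with
  | zero => exact h hk
  | one =>
    -- The fibre of a strip has at most two points in `𝓕⁰`, and the two ends of the arc already use
    -- them up; a third would contradict injectivity.
    obtain ⟨q, t, e⟩ := exists_range_eq_core hk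
    have mem : ∀ v, S.f (a.pt v) ∈ H.core q t := fun v => e ▸ mem_range_self v
    have inj := one_injective hk
    have h1 := H.core_inter_F0 (mem 0) (a.pt_end_mem_F0 (Or.inl rfl))
    have h2 := H.core_inter_F0 (mem 1) (a.pt_end_mem_F0 (Or.inr rfl))
    have h3 := H.core_inter_F0 (mem u) h0
    have n1 : S.f (a.pt 0) ≠ S.f (a.pt 1) := fun h => zero_ne_one (inj h)
    have n2 : S.f (a.pt 0) ≠ S.f (a.pt u) := fun h => hu.1.ne (inj h)
    have n3 : S.f (a.pt u) ≠ S.f (a.pt 1) := fun h => hu.2.ne (inj h)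
    generalize S.f (a.pt 0) = x at *
    generalize S.f (a.pt 1) = y at *
    generalize S.f (a.pt u) = z at *
    rcases h1 with h1 | h1 <;> rcases h2 with h2 | h2 <;> rcases h3 with h3 | h3 <;>
      first
      | exact n1 (h1.trans h2.symm)
      | exact n2 (h1.trans h3.symm)
      | exact n3 (h3.trans h2.symm)
  | outer => exact outer_notMem_surf hk hu ⟨h0.1, Or.inl h0.2⟩
  | free => exact free_notMem_bdH0 hk hu (H.F0_subset_bdH0 h0)

/-- A point over `∂M` is in `∂F`, hence on a side `D¹ × ∂g` of a 1-handle. That side either maps to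
the vertical boundary, which meets `𝓕⁰` in `∂𝓕⁰` only, or belongs to `∂F - ∂M`. -/
theorem zero_interior_notMem_bdry3 {a : S.Arc} (h : a.kind = .zero) {u : I}
    (hu : u ∈ Ioo (0 : I) 1) : S.f (a.pt u) ∉ bdry3 M := by
  intro h3
  have h2 := S.proper _ h3
  have h0 := zero_mem_F0 h u
  have hbd := zero_notMem_bdF0 h hu
  obtain ⟨c, ⟨s, t⟩, e⟩ := (S.preim1 _).1 h0.2
  rw [← e] at h3 h2 h0 hbd
  have ht : t = 0 ∨ t = 1 :=
    (eq_end_or_mem_Ioo t).resolve_right fun ht => S.e1_notMem_bdry c s ht h2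
  rcases S.crossArc_end c ht with h' | h'
  · exact hbd (S.e1_mem_bdF0_iff.2 ⟨S.e1_mem_F0_iff.1 h0, h'.1⟩)
  · exact (h'.2 s).2 h3

end Arc

/-- `𝓕⁰` is covered by the arcs of kind `Piece.zero`. -/
theorem mem_F0_iff_zero_arc {x : F} :
    S.f x ∈ H.F0 ↔ ∃ a : {a : S.Arc // a.kind = .zero}, x ∈ range a.1.pt := by
  constructor
  · intro h
    obtain ⟨a, u, hu, rfl⟩ := exists_pt_eq_of_mem_bdH0 (H.F0_subset_bdH0 h)
    rcases eq_zero_or_mem_Ioo hu with rfl | hu'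
    · obtain ⟨b, hb, -, hx⟩ := a.zero_end
      exact ⟨⟨b, hb⟩, hx⟩
    · refine ⟨⟨a, ?_⟩, u, rfl⟩
      by_contra hk
      exact Arc.notMem_F0 hk hu' h
  · rintro ⟨⟨a, ha⟩, u, rfl⟩
    exact Arc.zero_mem_F0 ha u

/-- `𝓕⁰` is covered by the ends of the 1-handles. -/
theorem mem_F0_iff_end {x : F} :
    S.f x ∈ H.F0 ↔ ∃ p : S.K1 × Bool, x ∈ range fun t => S.e1 p.1 (endpt p.2, t) := by
  constructor
  · intro h
    obtain ⟨c, ⟨s, t⟩, rfl⟩ := (S.preim1 x).1 h.2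
    obtain ⟨b, rfl⟩ := exists_endpt_eq (S.e1_mem_F0_iff.1 h)
    exact ⟨(c, b), t, rfl⟩
  · rintro ⟨⟨c, b⟩, t, rfl⟩
    exact S.e1_mem_F0_iff.2 (endpt_eq b)

theorem end_disjoint (p q : S.K1 × Bool) (x : F)
    (hp : x ∈ range fun t => S.e1 p.1 (endpt p.2, t))
    (hq : x ∈ range fun t => S.e1 q.1 (endpt q.2, t)) : p = q := by
  obtain ⟨t, rfl⟩ := hp
  obtain ⟨t', e⟩ := hq
  obtain ⟨h1, h2⟩ := S.e1_eq_iff.1 e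
  exact Prod.ext h1.symm (endpt_injective (congrArg Prod.fst h2)).symm

theorem continuous_end (p : S.K1 × Bool) : Continuous fun t => S.e1 p.1 (endpt p.2, t) :=
  (S.econt1 p.1).comp (by fun_prop)

theorem zero_arc_disjoint (a b : {a : S.Arc // a.kind = .zero}) (x : F) (ha : x ∈ range a.1.pt)
    (hb : x ∈ range b.1.pt) : a = b :=
  Subtype.ext (Arc.eq_of_mem_range ha hb (iff_of_true a.2 b.2))

/-- The corners of the 1-handles of `F`. -/
def corner (p : S.K1 × Bool × Bool) : F := S.e1 p.1 (endpt p.2.1, endpt p.2.2)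

theorem corner_injective : Function.Injective (corner (S := S)) := by
  rintro ⟨c, s, t⟩ ⟨c', s', t'⟩ h
  obtain ⟨h1, h2⟩ := S.e1_eq_iff.1 h
  have h3 := endpt_injective (congrArg Prod.fst h2)
  have h4 := endpt_injective (congrArg Prod.snd h2)
  dsimp only at h1 h3 h4
  rw [h1, h3, h4]

theorem pt_zero_injective : Function.Injective fun a : S.Arc => a.pt 0 :=
  fun _ _ h => (Arc.pt_eq_pt zero_lt_one zero_lt_one h).1

/-- If an arc meets an end of a 1-handle then both have the same end points. -/
theorem ends_eq_of_meet [T2Space F] {a : S.Arc} (ha : a.kind = .zero) {c : S.K1} {b : Bool}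
    {x : F} (hx : x ∈ range a.pt) (hx' : x ∈ range fun t => S.e1 c (endpt b, t)) :
    (a.pt 0 = corner (c, b, false) ∧ a.pt 1 = corner (c, b, true)) ∨
      (a.pt 0 = corner (c, b, true) ∧ a.pt 1 = corner (c, b, false)) := by
  -- The `zero` arc and the end of the 1-handle are both the component of `x` in the preimage of
  -- `𝓕⁰`, so they are two parametrisations of one arc.
  have h1 := connectedComponentIn_eq_range_of_arcs (S := S.f ⁻¹' H.F0)
    (γ := fun a : {a : S.Arc // a.kind = .zero} => a.1.pt)
    (fun a => a.1.continuous_pt) zero_arc_disjoint (fun x => mem_F0_iff_zero_arc) (i := ⟨a, ha⟩) hx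
  have h2 := connectedComponentIn_eq_range_of_arcs (S := S.f ⁻¹' H.F0)
    (γ := fun (p : S.K1 × Bool) t => S.e1 p.1 (endpt p.2, t))
    continuous_end end_disjoint (fun x => mem_F0_iff_end) (i := (c, b)) hx'
  exact arc_ends_eq a.continuous_pt (continuous_end (c, b)) a.pt_injective
    (fun t t' h => congrArg Prod.snd (S.e1_eq_iff.1 h).2) (h1.symm.trans h2)

/-- By alternation every starting point is an end of a `zero` arc, and `zero` arcs are the ends of
the 1-handles, which have the corners as end points. -/
theorem range_corner [T2Space F] : range (corner (S := S)) = range fun a : S.Arc => a.pt 0 := by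
  ext x
  constructor
  · rintro ⟨⟨c, b, b'⟩, rfl⟩
    have hx' : corner (c, b, b') ∈ range fun t => S.e1 c (endpt b, t) := ⟨endpt b', rfl⟩
    obtain ⟨⟨a, ha⟩, hx⟩ := mem_F0_iff_zero_arc.1 (mem_F0_iff_end.2 ⟨(c, b), hx'⟩)
    have := ends_eq_of_meet ha hx hx'
    rw [a.pt_one] at this
    cases b'
    · rcases this with h | h
      · exact ⟨_, h.1⟩
      · exact ⟨_, h.2⟩
    · rcases this with h | h
      · exact ⟨_, h.2⟩
      · exact ⟨_, h.1⟩
  · rintro ⟨a, rfl⟩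
    obtain ⟨z, hz, v, hv, e⟩ : ∃ z : S.Arc, z.kind = .zero ∧ ∃ v, (v = 0 ∨ v = 1) ∧
        z.pt v = a.pt 0 := by
      by_cases h : a.kind = .zero
      · exact ⟨a, h, 0, Or.inl rfl, rfl⟩
      · exact ⟨a.prev, a.kind_prev_eq_zero_iff.2 h, 1, Or.inr rfl, a.prev_pt_one⟩
    obtain ⟨⟨c, b⟩, hx⟩ := mem_F0_iff_end.1 (Arc.zero_mem_F0 hz v)
    have := ends_eq_of_meet hz ⟨v, rfl⟩ hx
    beta_reduce
    rw [← e]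
    rcases hv with rfl | rfl
    · rcases this with h | h
      · exact ⟨_, h.1.symm⟩
      · exact ⟨_, h.1.symm⟩
    · rcases this with h | h
      · exact ⟨_, h.2.symm⟩
      · exact ⟨_, h.2.symm⟩

end AdmissibleSurface

namespace AdmissibleSurface

variable {M : Type*} [TopologicalSpace M] [ChartedSpace (EuclideanHalfSpace 3) M]
  {H : HandleStructure M} {F : Type*} [TopologicalSpace F]
  [ChartedSpace (EuclideanHalfSpace 2) F] {S : AdmissibleSurface H F}

/-! ### The terms of the combinatorial area -/

theorem mem_circle_iff {c : S.K0} {x : F} :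
    x ∈ S.circle c ↔ ∃ a : S.Arc, a.1 = c ∧ ∃ u < 1, a.pt u = x := by
  constructor
  · rintro ⟨y, hy, rfl⟩
    exact Arc.exists_pt_eq hy
  · rintro ⟨a, rfl, u, -, rfl⟩
    exact ⟨_, norm_rim _, rfl⟩

theorem pt_mem_circle (a : S.Arc) (u : I) : a.pt u ∈ S.circle a.1 := ⟨_, norm_rim _, rfl⟩

theorem eq_of_mem_circle {c c' : S.K0} {x : F} (h : x ∈ S.circle c) (h' : x ∈ S.circle c') :
    c = c' := by
  obtain ⟨y, -, rfl⟩ := h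
  obtain ⟨y', -, e⟩ := h'
  exact (S.e0_eq_iff.1 e).1.symm

/-- The arc `a` runs over the strip `q`. -/
def Arc.RunsOver (a : S.Arc) (q : H.Strip) : Prop :=
  a.kind = .one ∧ ∀ u, S.f (a.pt u) ∈ H.strip q

theorem Arc.exists_runsOver {a : S.Arc} (h : a.kind = .one) : ∃ q, a.RunsOver q := by
  obtain ⟨q, t, e⟩ := exists_range_eq_core h
  exact ⟨q, h, fun u => H.core_subset_strip q t (e ▸ mem_range_self u)⟩

theorem Arc.RunsOver.unique {a : S.Arc} {q q' : H.Strip} (h : a.RunsOver q)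
    (h' : a.RunsOver q') : q = q' := H.strip_eq_of_mem (h.2 0) (h'.2 0)

/-- A strip meets `𝓕⁰` only in `∂𝓕⁰`, so its points avoid the interiors of `zero` arcs; `outer` and
`free` arcs miss the 2-handles within `∂𝓗⁰`. A `one` arc stays in a single strip, and strips are
disjoint. -/
theorem mem_strip_iff_arc {q : H.Strip} {x : F} :
    S.f x ∈ H.strip q ↔ ∃ a : {a : S.Arc // a.RunsOver q}, x ∈ range a.1.pt := by
  constructor
  · intro h
    have h2 := H.strip_subset_H2 q h
    have main : ∃ b : S.Arc, b.kind = .one ∧ x ∈ range b.pt := by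
      obtain ⟨a, u, hu, rfl⟩ := exists_pt_eq_of_mem_bdH0 (H.strip_subset_bdH0 q h)
      obtain ⟨b, hb, v, e⟩ : ∃ b : S.Arc, b.kind ≠ .zero ∧ ∃ v, b.pt v = a.pt u := by
        rcases eq_zero_or_mem_Ioo hu with rfl | hu'
        · obtain ⟨b, hb, -, hx⟩ := a.nonzero_end
          exact ⟨b, hb, hx⟩
        · refine ⟨a, fun hk => ?_, u, rfl⟩
          exact Arc.zero_notMem_bdF0 hk hu'
            (H.mem_bdF0_of_mem_F0_of_mem_H2 (Arc.zero_mem_F0 hk u) h2)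
      rw [← e] at h h2
      refine ⟨b, ?_, v, e⟩
      cases hk : b.kind with
      | zero => exact absurd hk hb
      | one => rfl
      | outer =>
        rcases eq_end_or_mem_Ioo v with hv | hv
        · exact absurd (H.strip_subset_F1 q h) (Arc.outer_ends hk hv).2
        · exact absurd ⟨pt_mem_H0 b v, Or.inr h2⟩ (Arc.outer_notMem_surf hk hv)
      | free =>
        rcases eq_end_or_mem_Ioo v with hv | hv
        · have := Arc.free_ends hk hv
          exact absurd (H.mem_bdF0_of_mem_F0_of_mem_H2 this.1 h2) this.2
        · exact absurd (H.strip_subset_bdH0 q h) (Arc.free_notMem_bdH0 hk hv)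
    obtain ⟨b, hb, v, rfl⟩ := main
    obtain ⟨q', hq'⟩ := Arc.exists_runsOver hb
    obtain rfl := H.strip_eq_of_mem h (hq'.2 v)
    exact ⟨⟨b, hq'⟩, v, rfl⟩
  · rintro ⟨a, u, rfl⟩
    exact a.2.2 u

theorem runsOver_disjoint {q : H.Strip} (a b : {a : S.Arc // a.RunsOver q}) (x : F)
    (ha : x ∈ range a.1.pt) (hb : x ∈ range b.1.pt) : a = b :=
  Subtype.ext (Arc.eq_of_mem_range ha hb (by rw [a.2.1, b.2.1]))

theorem numComp_circle_inter_strip [T2Space F] (c : S.K0) (q : H.Strip) :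
    numComp (S.circle c ∩ S.f ⁻¹' H.strip q) =
      Nat.card {a : S.Arc // a.RunsOver q ∧ a.1 = c} := by
  refine numComp_eq_card_of_arcs (γ := fun a => a.1.pt) (fun a => a.1.continuous_pt) ?_ ?_
  · intro a b x ha hb
    exact Subtype.ext (Arc.eq_of_mem_range ha hb (by rw [a.2.1.1, b.2.1.1]))
  · intro x
    constructor
    · rintro ⟨h1, h2⟩
      obtain ⟨⟨a, ha⟩, u, rfl⟩ := mem_strip_iff_arc.1 h2
      exact ⟨⟨a, ha, eq_of_mem_circle (pt_mem_circle a u) h1⟩, u, rfl⟩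
    · rintro ⟨⟨a, ha, rfl⟩, u, rfl⟩
      exact ⟨pt_mem_circle a u, ha.2 u⟩

/-- The arcs of the boundaries of the 2-handles of `F` in a given strip. -/
def evenArc (q : H.Strip) (c : S.K2) (u : I) : F :=
  S.e2 c (rim ((2 * (q.2 : ℝ) + u) / (2 * H.valence q.1)))

/-- Each 2-handle of `F` parallel to the 2-handle `k` runs once over each strip of `k`. -/
theorem card_runsOver [T2Space F] (q : H.Strip) :
    Nat.card {a : S.Arc // a.RunsOver q} = Nat.card {c : S.K2 // S.base2 c = q.1} := by
  -- The components of the preimage of the strip are counted twice: as arcs on the 0-handles, and as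
  -- even arcs on the boundaries of the 2-handles.
  rw [← numComp_eq_card_of_arcs (S := S.f ⁻¹' H.strip q)
    (γ := fun a : {a : S.Arc // a.RunsOver q} => a.1.pt) (fun a => a.1.continuous_pt)
    runsOver_disjoint (fun x => mem_strip_iff_arc)]
  refine numComp_eq_card_of_arcs (γ := fun c => evenArc q c.1) ?_ ?_ ?_
  · intro c
    exact (S.econt2 _).comp (continuous_rim.comp (by fun_prop))
  · rintro ⟨c, hc⟩ ⟨c', hc'⟩ x ⟨u, rfl⟩ ⟨u', e⟩
    exact Subtype.ext (S.e2_eq_iff.1 e).1.symm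
  · intro x
    constructor
    · intro h
      obtain ⟨c, y, rfl⟩ := (S.preim2 x).1 (H.strip_subset_H2 q h)
      obtain ⟨t, θ, hθ, e⟩ := mem_iUnion.1 h
      rw [f_e2] at e
      obtain ⟨h1, h2⟩ := H.h2_eq_iff.1 e
      refine ⟨⟨c, h1.symm⟩, ⟨θ - 2 * q.2, by linarith [hθ.1], by linarith [hθ.2]⟩, ?_⟩
      have h3 : rim (θ / (2 * H.valence q.1)) = y := congrArg Prod.fst h2
      have h4 : 2 * (q.2 : ℝ) + (θ - 2 * q.2) = θ := by ring
      simp only [evenArc, h4, h3]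
    · rintro ⟨⟨c, hc⟩, u, rfl⟩
      obtain ⟨k, r⟩ := q
      dsimp only at hc
      subst hc
      refine mem_iUnion.2 ⟨S.height c, 2 * (r : ℝ) + u, ⟨?_, ?_⟩, (S.f_e2 c _).symm⟩
      · linarith [u.2.1]
      · linarith [u.2.2]

/-- Points over `∂M` lie in `∂F`, hence on the boundary circle of the disc. There `one` arcs are
excluded because `∂F` avoids the 2-handles, and `free` arcs because they lie off `∂M`. -/
theorem numComp_disc_inter_bdry [T2Space F] (c : S.K0) :
    numComp (S.disc c ∩ S.f ⁻¹' bdry3 M) =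
      Nat.card {a : S.Arc // a.kind = .outer ∧ a.1 = c} := by
  refine numComp_eq_card_of_arcs (γ := fun a => a.1.pt) (fun a => a.1.continuous_pt) ?_ ?_
  · intro a b x ha hb
    exact Subtype.ext (Arc.eq_of_mem_range ha hb (by rw [a.2.1, b.2.1]))
  · intro x
    constructor
    · rintro ⟨⟨y, rfl⟩, h3⟩
      have hbd := S.proper _ h3
      obtain ⟨a, rfl, u, hu, e⟩ := exists_pt_eq_of_e0 (Or.inl hbd)
      rw [← e] at h3 hbd ⊢
      obtain ⟨b, hb, hba, v, e'⟩ : ∃ b : S.Arc, b.kind ≠ .zero ∧ b.1 = a.1 ∧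
          ∃ v, b.pt v = a.pt u := by
        rcases eq_zero_or_mem_Ioo hu with rfl | hu'
        · exact a.nonzero_end
        · exact ⟨a, fun hk => Arc.zero_interior_notMem_bdry3 hk hu' h3, rfl, u, rfl⟩
      rw [← e'] at h3 hbd ⊢
      refine ⟨⟨b, ?_, hba⟩, v, rfl⟩
      cases hk : b.kind with
      | zero => exact absurd hk hb
      | one => exact absurd (Arc.one_mem_F1 hk v).2 (S.bdry_two _ hbd)
      | outer => rfl
      | free => exact absurd h3 (Arc.free_mem_bdry hk v).2
    · rintro ⟨⟨a, ha, rfl⟩, u, rfl⟩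
      exact ⟨⟨_, rfl⟩, (Arc.outer_mem ha u).2⟩

/-- The components are the open `free` arcs: all end points of arcs are in `𝓕⁰`, hence on `∂𝓗⁰`, as
are the arcs of the other kinds. -/
theorem numComp_circle_sdiff [T2Space F] (c : S.K0) :
    numComp (S.circle c \ S.f ⁻¹' H.bdH0) =
      Nat.card {a : S.Arc // a.kind = .free ∧ a.1 = c} := by
  have hint : ∀ a : S.Arc, ∀ u, S.f (a.pt u) ∉ H.bdH0 → u ∈ Ioo (0 : I) 1 := fun a u h =>
    (eq_end_or_mem_Ioo u).resolve_left fun hu => h (H.F0_subset_bdH0 (a.pt_end_mem_F0 hu))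
  refine numComp_eq_card (A := fun a => a.1.pt '' Ioo 0 1) (C := fun a => range a.1.pt)
    (fun a => (isCompact_range a.1.continuous_pt).isClosed) ?_ ?_ ?_ ?_
  · rintro ⟨a, ha, rfl⟩
    ext x
    constructor
    · rintro ⟨h, u, rfl⟩
      exact ⟨u, hint a u h.2, rfl⟩
    · rintro ⟨u, hu, rfl⟩
      exact ⟨⟨pt_mem_circle a u, Arc.free_notMem_bdH0 ha hu⟩, u, rfl⟩
  · intro a b x ha hb
    exact Subtype.ext (Arc.eq_of_mem_range (image_subset_range _ _ ha)
      (image_subset_range _ _ hb) (by rw [a.2.1, b.2.1]))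
  · rintro x ⟨h1, h2⟩
    obtain ⟨a, rfl, u, -, rfl⟩ := mem_circle_iff.1 h1
    have hu := hint a u h2
    refine ⟨⟨a, ?_, rfl⟩, u, hu, rfl⟩
    cases hk : a.kind with
    | zero => exact absurd (H.F0_subset_bdH0 (Arc.zero_mem_F0 hk u)) h2
    | one =>
      obtain ⟨q, hq⟩ := Arc.exists_runsOver hk
      exact absurd (H.strip_subset_bdH0 q (hq.2 u)) h2
    | outer => exact absurd (Arc.outer_mem hk u).1 h2
    | free => rfl
  · intro a
    refine IsConnected.image ⟨?_, isPreconnected_Ioo⟩ _ a.1.continuous_pt.continuousOn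
    exact nonempty_Ioo.2 zero_lt_one

/-- A 1-handle `D¹ × g` meets `∂F - ∂M` in those of its two sides for which the end of `g` is
interior to `D²`; a side over `∂D²` lies in a 2-handle or in `∂M`. -/
theorem length_eq_card [T2Space F] :
    S.length = Nat.card {p : S.K1 × Bool // ‖(S.crossArc p.1 (endpt p.2) : ℂ)‖ < 1} := by
  refine numComp_eq_card_of_arcs (γ := fun p s => S.e1 p.1.1 (s, endpt p.1.2)) ?_ ?_ ?_
  · exact fun p => (S.econt1 _).comp (by fun_prop)
  · rintro ⟨⟨c, b⟩, hp⟩ ⟨⟨c', b'⟩, hp'⟩ x ⟨u, rfl⟩ ⟨u', e⟩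
    obtain ⟨h1, h2⟩ := S.e1_eq_iff.1 e
    exact Subtype.ext (Prod.ext h1.symm (endpt_injective (congrArg Prod.snd h2)).symm)
  · intro x
    constructor
    · rintro ⟨⟨h1, h2⟩, h3⟩
      obtain ⟨c, ⟨s, t⟩, rfl⟩ := (S.preim1 x).1 h3
      have ht : t = 0 ∨ t = 1 :=
        (eq_end_or_mem_Ioo t).resolve_right fun ht => S.e1_notMem_bdry c s ht h1
      obtain ⟨b, rfl⟩ := exists_endpt_eq ht
      rcases S.crossArc_end c ht with ⟨-, h | h⟩ | h
      · exact absurd (h s) (S.bdry_two _ h1)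
      · exact absurd (h s) h2
      · exact ⟨⟨(c, b), h.1⟩, s, rfl⟩
    · rintro ⟨⟨⟨c, b⟩, hp⟩, s, rfl⟩
      rcases S.crossArc_end c (endpt_eq b) with h | h
      · exact absurd h.1 hp.ne
      · exact ⟨h.2 s, S.e1_mem_H1 c _⟩

/-! ### Counting arcs -/

open scoped Classical in
/-- The number of arcs of a given kind. -/
def count (S : AdmissibleSurface H F) (k : Piece) : ℕ :=
  (Finset.univ.filter fun a : S.Arc => a.kind = k).card

/-- The bijection between arcs and corners of 1-handles, through the starting points of arcs. -/
theorem exists_arc_equiv_corner [T2Space F] :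
    ∃ e : S.Arc ≃ S.K1 × Bool × Bool, ∀ a, corner (e a) = a.pt 0 := by
  refine ⟨((Equiv.ofInjective _ pt_zero_injective).trans
    (Equiv.setCongr range_corner.symm)).trans (Equiv.ofInjective _ corner_injective).symm,
    fun a => ?_⟩
  exact Equiv.apply_ofInjective_symm corner_injective _

theorem card_arc [T2Space F] : Fintype.card S.Arc = 4 * Fintype.card S.K1 := by
  obtain ⟨e, -⟩ := exists_arc_equiv_corner (S := S)
  rw [Fintype.card_congr e, Fintype.card_prod, Fintype.card_prod, Fintype.card_bool]
  ring

/-- Passing to the next arc, as a permutation. -/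
def nextEquiv : S.Arc ≃ S.Arc := ⟨Arc.next, Arc.prev, Arc.prev_next, Arc.next_prev⟩

theorem card_arc_eq_sum : Fintype.card S.Arc =
    S.count .zero + (S.count .one + S.count .outer + S.count .free) := by
  classical
  simp only [count, Finset.card_filter, ← Finset.sum_add_distrib]
  rw [← Finset.card_univ, Finset.card_eq_sum_ones]
  refine Finset.sum_congr rfl fun a _ => ?_
  cases a.kind <;> simp

/-- By alternation, passing to the next arc exchanges `zero` arcs with all the others. -/
theorem count_zero : S.count .zero = S.count .one + S.count .outer + S.count .free := by
  classical
  simp only [count, Finset.card_filter, ← Finset.sum_add_distrib]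
  rw [← Equiv.sum_comp nextEquiv]
  refine Finset.sum_congr rfl fun a _ => ?_
  have : (nextEquiv a).kind = .zero ↔ a.kind ≠ .zero := a.kind_next_eq_zero_iff
  simp only [this]
  cases a.kind <;> simp

/-- Exactly one of the two arcs meeting at the point is not of kind `zero`, and its kind decides
whether the point is on `∂𝓕⁰`. -/
theorem pt_zero_notMem_bdF0_iff (a : S.Arc) :
    S.f (a.pt 0) ∉ H.bdF0 ↔ a.kind = .free ∨ a.prev.kind = .free := by
  have key : ∀ {b : S.Arc} {v : I}, (v = 0 ∨ v = 1) → b.kind ≠ .zero →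
      (S.f (b.pt v) ∉ H.bdF0 ↔ b.kind = .free) := by
    intro b v hv hb
    cases hk : b.kind with
    | zero => exact absurd hk hb
    | one =>
      simpa using H.mem_bdF0_of_mem_F0_of_mem_H2 (b.pt_end_mem_F0 hv) (Arc.one_mem_F1 hk v).2
    | outer => simpa using (Arc.outer_ends hk hv).1
    | free => simpa using (Arc.free_ends hk hv).2
  have hp := a.kind_prev_eq_zero_iff
  by_cases h : a.kind = .zero
  · rw [← a.prev_pt_one, key (Or.inr rfl) fun h' => hp.1 h' h, h]
    simp
  · simp [key (Or.inl rfl) h, hp.2 h]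

/-- The vertices in the interior of `𝓕⁰` are counted twice: each free arc has two of them as ends,
and so does each side of a 1-handle that lies in `∂F - ∂M`. -/
theorem length_eq_count_free [T2Space F] : S.length = S.count .free := by
  classical
  obtain ⟨e, he⟩ := exists_arc_equiv_corner (S := S)
  have h1 : ∑ a : S.Arc, (if S.f (a.pt 0) ∉ H.bdF0 then 1 else 0) = 2 * S.count .free := by
    -- The two alternatives exclude each other, since the predecessor of a `free` arc is a `zero`
    -- arc; so the indicators add up.
    have : ∀ a : S.Arc, (if S.f (a.pt 0) ∉ H.bdF0 then 1 else 0) =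
        (if a.kind = .free then 1 else 0) + if a.prev.kind = .free then 1 else 0 := by
      intro a
      rw [if_congr (pt_zero_notMem_bdF0_iff a) rfl rfl]
      have := a.kind_prev_eq_zero_iff
      by_cases h : a.kind = .free
      · have h' : a.prev.kind = .zero := this.2 (by simp [h])
        simp [h, h']
      · simp [h]
    simp only [this, Finset.sum_add_distrib, count, Finset.card_filter]
    rw [← Equiv.sum_comp nextEquiv.symm fun a : S.Arc => if a.kind = .free then 1 else 0, two_mul]
    congr 1
  have h2 : ∑ a : S.Arc, (if S.f (a.pt 0) ∉ H.bdF0 then 1 else 0) = 2 * S.length := by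
    have : ∀ a : S.Arc, (if S.f (a.pt 0) ∉ H.bdF0 then 1 else 0) =
        if ‖(S.crossArc (e a).1 (endpt (e a).2.2) : ℂ)‖ < 1 then 1 else 0 := by
      intro a
      refine if_congr ?_ rfl rfl
      rw [← he a, corner, S.e1_mem_bdF0_iff, and_iff_right (endpt_eq _)]
      exact ⟨fun h => lt_of_le_of_ne (norm_le_one_of_D2 _) h, fun h => h.ne⟩
    simp only [this]
    -- The condition on a corner involves the end of `g` but not the end of `D¹`; the latter yields
    -- the factor 2.
    rw [Equiv.sum_comp e fun p => if ‖(S.crossArc p.1 (endpt p.2.2) : ℂ)‖ < 1 then 1 else 0,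
      length_eq_card, Nat.card_eq_fintype_card, Fintype.card_subtype, Finset.card_filter]
    simp only [Fintype.sum_prod_type, Fintype.sum_bool]
    rw [Finset.mul_sum]
    exact Finset.sum_congr rfl fun c _ => by ring
  omega

theorem sum_card_fiber (P : S.Arc → Prop) :
    ∑ c : S.K0, Nat.card {a : S.Arc // P a ∧ a.1 = c} = Nat.card {a : S.Arc // P a} := by
  classical
  simp only [Nat.card_eq_fintype_card, Fintype.card_subtype]
  rw [Finset.card_eq_sum_card_fiberwise (f := fun a : S.Arc => a.1) (t := Finset.univ)
    (fun _ _ => Finset.mem_coe.2 (Finset.mem_univ _))]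
  simp only [Finset.filter_filter]

theorem card_kind (k : Piece) : Nat.card {a : S.Arc // a.kind = k} = S.count k := by
  classical
  rw [Nat.card_eq_fintype_card, Fintype.card_subtype, count]

theorem count_one : S.count .one = ∑ q : H.Strip, Nat.card {a : S.Arc // a.RunsOver q} := by
  classical
  simp only [Nat.card_eq_fintype_card, Fintype.card_subtype, count, Finset.card_filter]
  rw [Finset.sum_comm]
  refine Finset.sum_congr rfl fun a _ => ?_
  by_cases h : a.kind = .one
  · obtain ⟨q, hq⟩ := Arc.exists_runsOver h
    have : ∀ q', a.RunsOver q' ↔ q = q' := fun q' => ⟨hq.unique, fun h => h ▸ hq⟩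
    simp [h, this]
  · have : ∀ q, ¬ a.RunsOver q := fun q hq => h hq.1
    simp [h, this]

/-- Double counting through `card_runsOver`. The weights `ε` and `1` turn the angle condition around
the 2-handles of `M` into a global identity. -/
theorem sum_strip_eq [T2Space F] (w : H.Strip → ℝ) :
    ∑ q : H.Strip, w q * Nat.card {a : S.Arc // a.RunsOver q} =
      ∑ c : S.K2, ∑ r : Fin (H.valence (S.base2 c)), w ⟨S.base2 c, r⟩ := by
  classical
  have h1 : ∀ q : H.Strip, (w q * Nat.card {a : S.Arc // a.RunsOver q} : ℝ) =
      ∑ c : S.K2, if S.base2 c = q.1 then w q else 0 := by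
    intro q
    rw [card_runsOver, Nat.card_eq_fintype_card, Fintype.card_subtype, Finset.sum_ite]
    simp [mul_comm]
  simp only [h1]
  rw [Finset.sum_comm]
  refine Finset.sum_congr rfl fun c _ => ?_
  rw [Fintype.sum_sigma, Finset.sum_eq_single (S.base2 c)]
  · simp
  · intro k _ hk
    simp [hk.symm]
  · simp

/-- The exterior angles sum up to `π` times the number of strips that are run over, minus `2π` for
each 2-handle. -/
theorem sum_exterior_angles [T2Space F] {ε : H.Strip → ℝ} (hε : H.IsAngledSpine ε) :
    ∑ q : H.Strip, ε q * Nat.card {a : S.Arc // a.RunsOver q} =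
      Real.pi * S.count .one - 2 * Real.pi * Fintype.card S.K2 := by
  have h1 : (S.count .one : ℝ) = ∑ q : H.Strip, (1 : ℝ) * Nat.card {a : S.Arc // a.RunsOver q} := by
    rw [count_one]
    push_cast
    simp
  rw [h1, sum_strip_eq ε, sum_strip_eq fun _ => 1, Finset.mul_sum]
  have h2 : (2 * Real.pi * Fintype.card S.K2 : ℝ) = ∑ c : S.K2, 2 * Real.pi := by
    simp [mul_comm]
  rw [h2, ← Finset.sum_sub_distrib]
  refine Finset.sum_congr rfl fun c _ => ?_
  have := hε.interior_sum (S.base2 c)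
  rw [Finset.sum_sub_distrib] at this
  rw [Finset.mul_sum]
  simp only [mul_one]
  linarith

theorem area_eq [T2Space F] {ε : H.Strip → ℝ} (hε : H.IsAngledSpine ε) :
    S.area ε = Real.pi * S.count .one - 2 * Real.pi * Fintype.card S.K2
      - 2 * Real.pi * Fintype.card S.K0 + Real.pi * S.count .outer
      + 3 * Real.pi * S.count .free := by
  simp only [area, handleArea, Finset.sum_add_distrib, Finset.sum_sub_distrib, ← Finset.mul_sum,
    ← Nat.cast_sum, numComp_disc_inter_bdry, numComp_circle_sdiff, numComp_circle_inter_strip]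
  rw [Finset.sum_comm]
  simp only [← Finset.mul_sum, ← Nat.cast_sum, sum_card_fiber, card_kind, sum_exterior_angles hε]
  simp only [Finset.sum_const, Finset.card_univ, nsmul_eq_mul]
  ring

/-! ### The Euler characteristic -/

/-- Vertices are the starting points of arcs, edges the arcs and the sides `D¹ × ∂g`, faces the
handles. As the vertices are also the corners of the 1-handles, the sides end at vertices. -/
theorem hasEulerChar [T2Space F] : HasEulerChar F
    ((Fintype.card S.K0 : ℤ) - Fintype.card S.K1 + Fintype.card S.K2) := by
  obtain ⟨h, hh⟩ := exists_square_homeo_disc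
  let φ : S.Arc ⊕ S.K1 × Bool → I → F :=
    Sum.elim Arc.pt fun p s => S.e1 p.1 (s, endpt p.2)
  let ψ : S.K0 ⊕ S.K1 ⊕ S.K2 → I × I → F :=
    Sum.elim (fun c q => S.e0 c (h q)) (Sum.elim S.e1 fun c q => S.e2 c (h q))
  have tr : ∀ {A : Set M} {x y : F}, x = y → S.f x ∈ A → S.f y ∈ A := fun e h => e ▸ h
  have hside : ∀ (p : S.K1 × Bool) {s : I}, s ∈ Ioo (0 : I) 1 →
      S.f (S.e1 p.1 (s, endpt p.2)) ∉ H.H0 := fun p s hs h0 => by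
    rcases S.e1_mem_H0_iff.1 h0 with h | h
    · exact hs.1.ne' h
    · exact hs.2.ne h
  have hsq : ∀ (c : S.K1) {q : I × I}, q.1 ∈ Ioo (0 : I) 1 → S.f (S.e1 c q) ∉ H.H0 :=
    fun c q hq h0 => by
      rcases S.e1_mem_H0_iff.1 h0 with h | h
      · exact hq.1.ne' h
      · exact hq.2.ne h
  have hdisc : ∀ (c : S.K2) {q : I × I}, q.1 ∈ Ioo (0 : I) 1 → q.2 ∈ Ioo (0 : I) 1 →
      S.f (S.e2 c (h q)) ∉ H.H0 ∧ S.f (S.e2 c (h q)) ∉ H.H1 := fun c q h1 h2 => by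
    have := (hh q).2 ⟨h1, h2⟩
    exact not_or.1 fun h' => this.ne (S.e2_mem_H0_or_H1_iff.1 h')
  have he0 : ∀ c y, S.f (S.e0 c y) ∈ H.H0 := fun c y => (S.preim0 _).2 ⟨c, y, rfl⟩
  have hpt : ∀ (a : S.Arc) u (c : S.K0) {q : I × I}, q.1 ∈ Ioo (0 : I) 1 → q.2 ∈ Ioo (0 : I) 1 →
      a.pt u ≠ S.e0 c (h q) := fun a u c q h1 h2 e => by
    have h3 := (S.e0_eq_iff.1 e).2
    have h4 := (hh q).2 ⟨h1, h2⟩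
    rw [← h3, norm_rim] at h4
    exact lt_irrefl _ h4
  have key := hasEulerChar_of_cells (fun a : S.Arc => a.pt 0) φ ψ ?_ ?_ ?_ ?_ pt_zero_injective
    ?_ ?_ ?_ ?_ ?_ ?_ ?_ ?_
  · convert key using 1
    simp only [Fintype.card_sum, Fintype.card_prod, Fintype.card_bool, card_arc]
    push_cast
    ring
  · rintro (a | p)
    · exact a.continuous_pt
    · exact (S.econt1 _).comp (by fun_prop)
  · rintro (c | c | c)
    · exact (S.econt0 c).comp h.continuous
    · exact S.econt1 c
    · exact (S.econt2 c).comp h.continuous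
  · rintro (a | p)
    · exact a.pt_injective
    · exact fun s s' e => congrArg Prod.fst (S.e1_eq_iff.1 e).2
  · rintro (c | c | c)
    · exact fun q q' e => h.injective (S.e0_eq_iff.1 e).2
    · exact fun q q' e => (S.e1_eq_iff.1 e).2
    · exact fun q q' e => h.injective (S.e2_eq_iff.1 e).2
  · rintro a (b | p) t ht e
    · exact ht.1.ne (Arc.pt_eq_pt zero_lt_one ht.2 e).2
    · exact hside p ht (tr e (pt_mem_H0 a 0))
  · rintro a (c | c | c) q h1 h2 e
    · exact hpt a 0 c h1 h2 e
    · exact hsq c h1 (tr e (pt_mem_H0 a 0))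
    · exact (hdisc c h1 h2).1 (tr e (pt_mem_H0 a 0))
  · rintro (a | p) (b | p') t ht s hs e
    · rw [(Arc.pt_eq_pt ht.2 hs.2 e).1]
    · exact absurd (tr e (pt_mem_H0 a t)) (hside p' hs)
    · exact absurd (tr e.symm (pt_mem_H0 b s)) (hside p ht)
    · obtain ⟨h1, h2⟩ := S.e1_eq_iff.1 e
      rw [Prod.ext h1 (endpt_injective (congrArg Prod.snd h2))]
  · rintro (a | p) (c | c | c) t ht q h1 h2 e
    · exact hpt a t c h1 h2 e
    · exact hsq c h1 (tr e (pt_mem_H0 a t))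
    · exact (hdisc c h1 h2).1 (tr e (pt_mem_H0 a t))
    · exact hside p ht (tr e.symm (he0 c (h q)))
    · have h3 := congrArg Prod.snd (S.e1_eq_iff.1 e).2
      dsimp only at h3
      rw [← h3] at h2
      rcases endpt_eq p.2 with h4 | h4
      · exact h2.1.ne' h4
      · exact h2.2.ne h4
    · exact (hdisc c h1 h2).2 (tr e (S.e1_mem_H1 p.1 (t, endpt p.2)))
  · rintro (c | c | c) (c' | c' | c') q h1 h2 q' h1' h2' e
    · rw [(S.e0_eq_iff.1 e).1]
    · exact absurd (tr e (he0 c (h q))) (hsq c' h1')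
    · exact absurd (tr e (he0 c (h q))) (hdisc c' h1' h2').1
    · exact absurd (tr e.symm (he0 c' (h q'))) (hsq c h1)
    · rw [(S.e1_eq_iff.1 e).1]
    · exact absurd (tr e (S.e1_mem_H1 c q)) (hdisc c' h1' h2').2
    · exact absurd (tr e.symm (he0 c' (h q'))) (hdisc c h1 h2).1
    · exact absurd (tr e.symm (S.e1_mem_H1 c' q')) (hdisc c h1 h2).2
    · rw [(S.e2_eq_iff.1 e).1]
  · rintro (a | p) t ht
    · rcases ht with rfl | rfl
      · exact ⟨a, rfl⟩
      · exact ⟨a.next, a.pt_one.symm⟩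
    · obtain ⟨b, rfl⟩ := exists_endpt_eq ht
      rw [← range_corner]
      exact ⟨(p.1, b, p.2), rfl⟩
  · have hside' : ∀ (c : S.K1) (s : I) {t : I}, t = 0 ∨ t = 1 →
        ∃ j u, φ j u = S.e1 c (s, t) := fun c s t ht => by
      obtain ⟨b, rfl⟩ := exists_endpt_eq ht
      exact ⟨.inr (c, b), s, rfl⟩
    rintro (c | c | c) q hq
    · have hn := (norm_le_one_of_D2 (h q)).eq_of_not_lt fun h' => hq ((hh q).1 h')
      obtain ⟨a, -, u, -, e⟩ := Arc.exists_pt_eq (S := S) (c := c) hn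
      exact ⟨.inl a, u, e⟩
    · obtain ⟨s, t⟩ := q
      rcases eq_end_or_mem_Ioo s with hs | hs
      · obtain ⟨a, u, e⟩ := mem_F0_iff_zero_arc.1 (S.e1_mem_F0_iff (c := c) (p := (s, t)) |>.2 hs)
        exact ⟨.inl a, u, e⟩
      · rcases eq_end_or_mem_Ioo t with ht | ht
        · exact hside' c s ht
        · exact absurd ⟨hs, ht⟩ hq
    · have hn := (norm_le_one_of_D2 (h q)).eq_of_not_lt fun h' => hq ((hh q).1 h')
      obtain ⟨θ, hθ⟩ := exists_rim_eq hn
      -- The boundary of a 2-handle is covered by edges: even arcs map to `∂𝓗⁰`, so they lie on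
      -- circles of 0-handles; odd arcs lie over `D¹ × ∂D²`, hence on sides of 1-handles.
      rcases H.rim_even_or_odd (S.base2 c) θ with ⟨r, τ, hτ, e⟩ | ⟨r, s, e⟩
      · have hmem : S.f (S.e2 c (h q)) ∈ H.bdH0 := by
          rw [f_e2, ← hθ, e]
          exact H.even_arc_mem_bdH0 (Ioo_subset_Icc_self hτ)
        obtain ⟨a, u, -, e'⟩ := exists_pt_eq_of_mem_bdH0 hmem
        exact ⟨.inl a, u, e'⟩
      · obtain ⟨j, p, -, e'⟩ := H.odd_arc_mem (S.base2 c) r s (S.height c)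
        have hmem : S.f (S.e2 c (h q)) ∈ H.H1 := by
          rw [f_e2, ← hθ, e, e']
          exact ⟨j, p, rfl⟩
        obtain ⟨c', ⟨s', t'⟩, e1⟩ := (S.preim1 _).1 hmem
        have hn' : ‖(S.crossArc c' t' : ℂ)‖ = 1 := by
          have e2 := congrArg S.f e1
          rw [f_e1, f_e2] at e2
          exact H.norm_eq_one_of_h2_eq_h1 e2.symm
        obtain ⟨j, u, e3⟩ := hside' c' s' (S.end_of_norm_crossArc hn')
        exact ⟨j, u, e3.trans e1⟩
  · intro x
    rcases H.cover (S.f x) with h0 | h1 | h2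
    · obtain ⟨c, y, rfl⟩ := (S.preim0 x).1 h0
      exact ⟨.inl c, h.symm y, congrArg (S.e0 c) (h.apply_symm_apply y)⟩
    · obtain ⟨c, y, rfl⟩ := (S.preim1 x).1 h1
      exact ⟨.inr (.inl c), y, rfl⟩
    · obtain ⟨c, y, rfl⟩ := (S.preim2 x).1 h2
      exact ⟨.inr (.inr c), h.symm y, congrArg (S.e2 c) (h.apply_symm_apply y)⟩

/-- The Gauss–Bonnet formula for admissible surfaces. -/
theorem area_eq_euler [T2Space F] {ε : H.Strip → ℝ} (hε : H.IsAngledSpine ε) :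
    S.area ε = -2 * Real.pi *
        (((Fintype.card S.K0 : ℤ) - Fintype.card S.K1 + Fintype.card S.K2 : ℤ) : ℝ)
      + 2 * Real.pi * (S.length : ℝ) := by
  rw [area_eq hε, length_eq_count_free]
  have h1 := card_arc_eq_sum (S := S)
  rw [card_arc, ← count_zero] at h1
  have h2 : S.count .one + S.count .outer + S.count .free = 2 * Fintype.card S.K1 := by
    rw [← count_zero]
    omega
  -- Half of the 4 K1 arcs are not of kind `zero`. After Length absorbs 2π of each 3π, every such
  -- arc carries weight π, which produces the term 2π K1.
  have h3 : (S.count .one + S.count .outer + S.count .free : ℝ) = 2 * Fintype.card S.K1 := by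
    exact_mod_cast h2
  push_cast
  linear_combination Real.pi * h3

end AdmissibleSurface

end GaussBonnet

end

/-! ### The Gauss–Bonnet formula for admissible surfaces -/

theorem proposition4p3
    {M : Type*} [TopologicalSpace M] [T2Space M] [CompactSpace M]
    [ChartedSpace (EuclideanHalfSpace 3) M]
    (H : GaussBonnet.HandleStructure M)
    (ε : H.Strip → ℝ) (hε : H.IsAngledSpine ε)
    {F : Type*} [TopologicalSpace F] [T2Space F] [CompactSpace F]
    [ChartedSpace (EuclideanHalfSpace 2) F]
    (S : GaussBonnet.AdmissibleSurface H F) :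
    ∃ χ : ℤ, GaussBonnet.HasEulerChar F χ ∧
      S.area ε = -2 * Real.pi * (χ : ℝ) + 2 * Real.pi * (S.length : ℝ) := by
  exact ⟨_, GaussBonnet.AdmissibleSurface.hasEulerChar (S := S),
    GaussBonnet.AdmissibleSurface.area_eq_euler hε⟩
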